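/- Let $d\in\mathbb N$, let $\sigma,\sigma'>1$ be conjugate exponents ($\tfrac1\sigma+\tfrac1{\sigma'}=1$) with $\frac{d}{d-1}<\sigma'<d$, let $k=1+\frac d\sigma$ satisfy $2<k<1+\frac d2$ (so that $d>2$), and let $p=\frac{d}{k-2}$, $\tfrac1p+\tfrac1{p'}=1$. Let $R>0$ and $B_r=\{x\in\mathbb R^d:|x|<r\}$. Then there is a constant $C$, depending only on $d,\sigma',R$ and on an upper bound $M$ for $\|\rho\|_{L^1(B_R)}$ (and hence not on $\Omega,\lambda,b,\psi$), such that the following holds. Let $\Omega\subset\mathbb R^d$ be open with $B_R\subset\Omega$, let $\lambda>0$, and let $\rho\in W^{1,2}_{\rm loc}(\Omega)$ be a weak solution of $$-\Delta\rho+\lambda\rho+\mathrm{div}(b\rho)=\psi\quad\text{in }\Omega,$$ that is, $b\rho,\psi\in L^1_{\rm loc}(\Omega)$ and $$\int_\Omega D\rho\cdot D\varphi\,dx+\lambda\int_\Omega\rho\varphi\,dx-\int_\Omega \rho\, b\cdot D\varphi\,dx=\int_\Omega\psi\varphi\,dx\qquad\text{for all }\varphi\in C_c^\infty(\Omega).$$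 Suppose that $\rho\ge0$ a.e. in $B_R$, that $\psi\in L^{p'}(B_R)$, and that $|b|\in L^k_{\rm loc}(B_R;\rho\,dx)$. Then $\rho\in W^{1,\sigma'}_{\rm loc}(\Omega)$. If moreover $\|\rho\|_{L^1(B_R)}\le M<\infty$, then $$\|\rho\|_{L^{\frac{d}{d-k}}(B_{R/2})}+\|D\rho\|_{L^{\sigma'}(B_{R/2})}\le C\left(\int_{B_R}|b|^k\rho\,dx+\|\psi\|_{L^{p'}(B_R)}+1\right),$$ where the right-hand side is understood as $+\infty$ if $\int_{B_R}|b|^k\rho\,dx=\infty$. -/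

import Mathlib

open MeasureTheory Set
open scoped ENNReal NNReal ContDiff

/-- `φ ∈ C_c^∞(Ω)`: a smooth real function with compact support contained in `Ω`. -/
structure IsTestFn {d : ℕ} (Ω : Set (EuclideanSpace ℝ (Fin d)))
    (φ : EuclideanSpace ℝ (Fin d) → ℝ) : Prop where
  smooth : ContDiff ℝ ∞ φ
  compact : HasCompactSupport φ
  support_subset : tsupport φ ⊆ Ω

/-- `f ∈ L^p_loc(Ω; μ)`: `f` is in `L^p` of every compact subset of `Ω`. -/
def MemLpLoc {d : ℕ} {F : Type*} [NormedAddCommGroup F]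
    (Ω : Set (EuclideanSpace ℝ (Fin d))) (p : ℝ≥0∞)
    (μ : Measure (EuclideanSpace ℝ (Fin d))) (f : EuclideanSpace ℝ (Fin d) → F) : Prop :=
  ∀ K : Set (EuclideanSpace ℝ (Fin d)), IsCompact K → K ⊆ Ω → MemLp f p (μ.restrict K)

/-- `g` is the weak (distributional) gradient of `u` on the open set `Ω`. The vector identity
collects the `d` identities `∫ u ∂ᵢφ = - ∫ gᵢ φ`. -/
structure HasWeakGradient {d : ℕ} (Ω : Set (EuclideanSpace ℝ (Fin d)))
    (u : EuclideanSpace ℝ (Fin d) → ℝ)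
    (g : EuclideanSpace ℝ (Fin d) → EuclideanSpace ℝ (Fin d)) : Prop where
  locInt_fun : LocallyIntegrableOn u Ω
  locInt_grad : LocallyIntegrableOn g Ω
  integral_eq : ∀ φ : EuclideanSpace ℝ (Fin d) → ℝ, IsTestFn Ω φ →
    ∫ x in Ω, u x • gradient φ x = - ∫ x in Ω, φ x • g x

/-- `u ∈ W^{1,q}_loc(Ω)` with weak gradient `Du = g` (which is determined almost everywhere
on `Ω` by `u`). -/
structure MemW1Loc {d : ℕ} (Ω : Set (EuclideanSpace ℝ (Fin d))) (q : ℝ≥0∞)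
    (u : EuclideanSpace ℝ (Fin d) → ℝ)
    (g : EuclideanSpace ℝ (Fin d) → EuclideanSpace ℝ (Fin d)) : Prop where
  weakGrad : HasWeakGradient Ω u g
  fun_mem : MemLpLoc Ω q volume u
  grad_mem : MemLpLoc Ω q volume g

/-- `ρ`, with weak gradient `Dρ`, is a weak solution of `-Δρ + lam ρ + div (b ρ) = ψ` in `Ω`,
tested against `C_c^∞(Ω)`. The two local integrability conditions are what is needed for the
terms of the weak formulation to be defined. -/
structure IsWeakSol {d : ℕ} (Ω : Set (EuclideanSpace ℝ (Fin d))) (lam : ℝ)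
    (b : EuclideanSpace ℝ (Fin d) → EuclideanSpace ℝ (Fin d))
    (ψ ρ : EuclideanSpace ℝ (Fin d) → ℝ)
    (Dρ : EuclideanSpace ℝ (Fin d) → EuclideanSpace ℝ (Fin d)) : Prop where
  locInt_flux : LocallyIntegrableOn (fun x => ρ x • b x) Ω
  locInt_source : LocallyIntegrableOn ψ Ω
  weak_form : ∀ φ : EuclideanSpace ℝ (Fin d) → ℝ, IsTestFn Ω φ →
    (∫ x in Ω, inner ℝ (Dρ x) (gradient φ x)) + lam * (∫ x in Ω, ρ x * φ x)
      - (∫ x in Ω, inner ℝ (ρ x • b x) (gradient φ x)) = ∫ x in Ω, ψ x * φ x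

/-- The measure `ρ dx` on the set `S` (for `ρ` nonnegative almost everywhere on `S`). -/
noncomputable def densityMeasure {d : ℕ} (S : Set (EuclideanSpace ℝ (Fin d)))
    (ρ : EuclideanSpace ℝ (Fin d) → ℝ) : Measure (EuclideanSpace ℝ (Fin d)) :=
  (volume.restrict S).withDensity (fun x => ENNReal.ofReal (ρ x))

/-! The estimate is a superlinear absorption argument that needs no smallness of the drift. Put s =
(d-2)/(d-k), r = d/(d-k), θ = 1 - 2/k, q = 1/p, and test the equation with ρ^(s-1) η^(2m), η a
cutoff. The exponents are tuned so that every term is controlled by a power of I = ∫ ρ^r η^N. The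
drift leaves ρ^s |b|² = (ρ|b|^k)^(1-θ) (ρ^r)^θ, hence I^θ by Hölder; the cutoff term leaves ρ^s =
ρ^(1-θ) (ρ^r)^θ, hence again I^θ, at the price of the L¹ mass; the source leaves |ψ| ρ^(s-1) = |ψ|
(ρ^r)^q, hence I^q. Sobolev applied to ρ^(s/2) η^m bounds I^((d-2)/d) by these. Since k < d, q ≤ θ <
(d-2)/d, so I is bounded (`exists_energy_bound`). Hölder between the energy density ρ^(s-2)|Dρ|² and
ρ^r then gives Dρ in L^σ', because σ' < 2 (`eLpNorm_le_of_energy_le`).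

The computation is legitimate for smooth positive functions, so the equation is mollified. What the
argument uses of the data are the pointwise bounds |F|² ≤ B^(1-θ) w^(1+θ) and |g| ≤ G^(1-q). Both
survive mollification by Jensen (`norm_mollify_le`), the integrals of B and G do not grow, and the λ
term is dropped by its sign (`IsWeakSol.mollify_le`). Adding ε > 0 gives positivity, and Fatou
removes the mollification.

This yields a fixed constant for data of size at most one. For fixed b the equation is linear in (ρ,
ψ), so dividing by the total size S of the data turns it into a bound linear in S. The membership in
W^{1,σ'}_loc follows from W^{1,2}_loc alone, since σ' < 2. -/

/-- Hölder's inequality in geometric-mean form. -/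
theorem integral_rpow_mul_rpow_le {α : Type*} [MeasurableSpace α] {μ : Measure α} {f g : α → ℝ}
    (hf : 0 ≤ᵐ[μ] f) (hg : 0 ≤ᵐ[μ] g) (hfi : Integrable f μ) (hgi : Integrable g μ)
    {a b : ℝ} (ha : 0 < a) (hb : 0 < b) (hab : a + b = 1) :
    Integrable (fun x => f x ^ a * g x ^ b) μ ∧
      ∫ x, f x ^ a * g x ^ b ∂μ ≤ (∫ x, f x ∂μ) ^ a * (∫ x, g x ∂μ) ^ b := by
  have hmem : ∀ {h : α → ℝ} {c : ℝ}, 0 ≤ᵐ[μ] h → Integrable h μ → 0 < c →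
      MemLp (fun x => h x ^ c) (ENNReal.ofReal (1 / c)) μ := by
    intro h c h0 hi hc
    have h1 := (memLp_one_iff_integrable.2 hi).norm_rpow_div (ENNReal.ofReal c)
    rw [ENNReal.toReal_ofReal hc.le] at h1
    rw [one_div, ENNReal.ofReal_inv_of_pos hc, ← one_div]
    refine h1.ae_eq ?_
    filter_upwards [h0] with x hx
    rw [Real.norm_of_nonneg hx]
  have hpq : (1 / a).HolderConjugate (1 / b) := by
    rw [Real.holderConjugate_iff]
    refine ⟨by rw [lt_div_iff₀ ha]; linarith, by simpa using hab⟩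
  have hma := hmem hf hfi ha
  have hmb := hmem hg hgi hb
  constructor
  · have : (ENNReal.ofReal (1 / a)).HolderConjugate (ENNReal.ofReal (1 / b)) := hpq.ennrealOfReal
    exact hma.integrable_mul hmb
  · have hpow : ∀ {h : α → ℝ} {c : ℝ}, 0 ≤ᵐ[μ] h → 0 < c →
        ∫ x, (h x ^ c) ^ (1 / c) ∂μ = ∫ x, h x ∂μ := by
      intro h c h0 hc
      refine integral_congr_ae ?_
      filter_upwards [h0] with x hx
      rw [← Real.rpow_mul hx, mul_one_div_cancel hc.ne', Real.rpow_one]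
    have h2 := integral_mul_le_Lp_mul_Lq_of_nonneg hpq (f := fun x => f x ^ a)
      (g := fun x => g x ^ b)
      (hf.mono fun x hx => Real.rpow_nonneg hx _) (hg.mono fun x hx => Real.rpow_nonneg hx _)
      hma hmb
    rw [hpow hf ha, hpow hg hb, one_div_one_div, one_div_one_div] at h2
    exact h2

/-- Absorption: for I ≥ 1 the smaller power I^q is dominated by I^θ, leaving I^(β-θ) ≤ 2c. The bound
depends only on c and the exponents. -/
theorem exists_bound_of_rpow_le {q θ β c : ℝ} (hqθ : q ≤ θ) (hθβ : θ < β) (hc : 0 ≤ c) :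
    ∃ C : ℝ, 1 ≤ C ∧ ∀ I : ℝ, I ^ β ≤ c * (I ^ θ + I ^ q) → I ≤ C := by
  refine ⟨max 1 ((2 * c) ^ (1 / (β - θ))), le_max_left _ _, fun I hI => ?_⟩
  rcases le_total I 1 with h1 | h1
  · exact h1.trans (le_max_left _ _)
  refine le_trans ?_ (le_max_right _ _)
  have hI0 : 0 < I := by linarith
  have hq : I ^ q ≤ I ^ θ := Real.rpow_le_rpow_of_exponent_le h1 hqθ
  have h2 : I ^ (β - θ) ≤ 2 * c := by
    rw [Real.rpow_sub hI0, div_le_iff₀ (Real.rpow_pos_of_pos hI0 _)]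
    nlinarith
  have h3 := Real.rpow_le_rpow (Real.rpow_nonneg hI0.le _) h2
    (by apply one_div_nonneg.2; linarith : 0 ≤ 1 / (β - θ))
  rwa [← Real.rpow_mul hI0.le, mul_one_div_cancel (by linarith), Real.rpow_one] at h3

/-! ### Gradients of smooth functions -/

section Gradient

variable {E : Type*} [NormedAddCommGroup E] [InnerProductSpace ℝ E] [CompleteSpace E]

theorem hasGradientAt_rpow_mul_pow {w η : E → ℝ} {x : E} (hw : DifferentiableAt ℝ w x)
    (hη : DifferentiableAt ℝ η x) (hpos : 0 < w x) (α : ℝ) (n : ℕ) :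
    HasGradientAt (fun y => w y ^ α * η y ^ n)
      ((α * w x ^ (α - 1) * η x ^ n) • gradient w x
        + (n * w x ^ α * η x ^ (n - 1)) • gradient η x) x := by
  rw [hasGradientAt_iff_hasFDerivAt]
  have h := (hw.hasFDerivAt.rpow_const (p := α) (Or.inl hpos.ne')).mul (hη.hasFDerivAt.pow n)
  refine h.congr_fderiv ?_
  ext v
  simp only [gradient, map_add, map_smul]
  simp
  ring

theorem norm_gradient_eq (f : E → ℝ) (x : E) : ‖gradient f x‖ = ‖fderiv ℝ f x‖ := by
  simp [gradient]

theorem ContDiff.continuous_gradient {f : E → ℝ} (hf : ContDiff ℝ ∞ f) :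
    Continuous (gradient f) :=
  (InnerProductSpace.toDual ℝ E).symm.continuous.comp (hf.continuous_fderiv (by simp))

theorem gradient_eq_zero_of_notMem_tsupport {f : E → ℝ} {x : E} (hx : x ∉ tsupport f) :
    gradient f x = 0 := by
  have h : fderiv ℝ f x = 0 := by
    by_contra h0
    exact hx (support_fderiv_subset ℝ h0)
  simp [gradient, h]

end Gradient

/-! ### Sobolev and Young inequalities -/

/-- The Sobolev inequality `‖v‖_{2d/(d-2)} ≤ C ‖∇v‖_2` in integral form. -/
theorem exists_sobolev_integral (d : ℕ) (hd : 2 < d) :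
    ∃ C : ℝ, 0 ≤ C ∧ ∀ v : EuclideanSpace ℝ (Fin d) → ℝ, ContDiff ℝ ∞ v → HasCompactSupport v →
      (∫ x, |v x| ^ (2 * d / (d - 2) : ℝ)) ^ ((d - 2) / d : ℝ) ≤
        C * ∫ x, ‖gradient v x‖ ^ 2 := by
  have hd' : (2 : ℝ) < d := by exact_mod_cast hd
  set t : ℝ := 2 * d / (d - 2) with ht
  have ht0 : 0 < t := by apply div_pos <;> linarith
  set c : ℝ≥0 := SNormLESNormFDerivOfEqConst ℝ
    (volume : Measure (EuclideanSpace ℝ (Fin d))) ((2 : ℝ≥0) : ℝ) with hc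
  refine ⟨c ^ 2, by positivity, fun v hv hvc => ?_⟩
  have h := eLpNorm_le_eLpNorm_fderiv_of_eq (μ := (volume : Measure (EuclideanSpace ℝ (Fin d))))
    (u := v) (hv.of_le (by simp)) hvc (p := 2) (p' := t.toNNReal) (by norm_num)
    (by rw [finrank_euclideanSpace_fin]; omega)
    (by
      rw [Real.coe_toNNReal _ ht0.le, finrank_euclideanSpace_fin, ht]
      have : (d : ℝ) - 2 ≠ 0 := by linarith
      push_cast
      field_simp)
  have hmem : MemLp v t.toNNReal volume := hv.continuous.memLp_of_hasCompactSupport hvc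
  have hDc : Continuous (fderiv ℝ v) := hv.continuous_fderiv (by simp)
  have hmem2 : MemLp (fderiv ℝ v) ((2 : ℝ≥0) : ℝ≥0∞) volume :=
    hDc.memLp_of_hasCompactSupport (hvc.fderiv ℝ)
  rw [hmem.eLpNorm_eq_integral_rpow_norm (by simpa using ht0) (by simp),
    hmem2.eLpNorm_eq_integral_rpow_norm (by simp) (by simp), ← hc,
    ← ENNReal.ofReal_coe_nnreal (p := c), ← ENNReal.ofReal_mul (by positivity),
    ENNReal.ofReal_le_ofReal_iff (by positivity)] at h
  have h2 := pow_le_pow_left₀ (by positivity) h 2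
  rw [mul_pow] at h2
  simp only [ENNReal.coe_toReal, Real.coe_toNNReal _ ht0.le, Real.norm_eq_abs, NNReal.coe_ofNat,
    ← norm_gradient_eq, Real.rpow_ofNat] at h2
  rw [← Real.rpow_natCast (_ ^ _) 2, ← Real.rpow_mul (by positivity),
    ← Real.rpow_natCast (_ ^ (2 : ℝ)⁻¹) 2, ← Real.rpow_mul (by positivity)] at h2
  have e1 : t⁻¹ * ((2 : ℕ) : ℝ) = (d - 2) / d := by
    rw [ht]; push_cast
    have : (d : ℝ) - 2 ≠ 0 := by linarith
    field_simp
  rw [e1] at h2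
  simpa using h2

section Young

variable {E : Type*} [NormedAddCommGroup E] [InnerProductSpace ℝ E]

/-- Half of the good term c‖a‖² survives once ⟨f, a⟩ and ⟨a, h⟩ have each cost c/4 of it. In the
energy estimate c = s - 1, and a, f, h carry ∇w, F and ∇η respectively. -/
theorem young_energy (a f h : E) {c m : ℝ} (hc : 0 < c) (hm : 0 ≤ m) :
    c / 2 * ‖a‖ ^ 2 ≤ c * inner ℝ (a - f) a + 2 * m * inner ℝ (a - f) h
      + (c + m) * ‖f‖ ^ 2 + (4 * m ^ 2 / c + m) * ‖h‖ ^ 2 := by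
  have h1 : inner ℝ f a ≤ ‖f‖ * ‖a‖ := real_inner_le_norm _ _
  have h2 : -inner ℝ a h ≤ ‖a‖ * ‖h‖ := (neg_le_abs _).trans (abs_real_inner_le_norm _ _)
  have h3 : inner ℝ f h ≤ ‖f‖ * ‖h‖ := real_inner_le_norm _ _
  rw [inner_sub_left, inner_sub_left, real_inner_self_eq_norm_sq]
  have q1 : c * (‖f‖ * ‖a‖) ≤ c / 4 * ‖a‖ ^ 2 + c * ‖f‖ ^ 2 := by
    nlinarith [mul_nonneg hc.le (sq_nonneg (‖a‖ / 2 - ‖f‖))]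
  have q2 : 2 * m * (‖a‖ * ‖h‖) ≤ c / 4 * ‖a‖ ^ 2 + 4 * m ^ 2 / c * ‖h‖ ^ 2 := by
    have : 0 ≤ (c * ‖a‖ / 2 - 2 * m * ‖h‖) ^ 2 / c := by positivity
    have e : (c * ‖a‖ / 2 - 2 * m * ‖h‖) ^ 2 / c =
        c / 4 * ‖a‖ ^ 2 + 4 * m ^ 2 / c * ‖h‖ ^ 2 - 2 * m * (‖a‖ * ‖h‖) := by
      field_simp; ring
    linarith
  have q3 : 2 * m * (‖f‖ * ‖h‖) ≤ m * ‖f‖ ^ 2 + m * ‖h‖ ^ 2 := by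
    nlinarith [mul_nonneg hm (sq_nonneg (‖f‖ - ‖h‖))]
  have r1 := mul_le_mul_of_nonneg_left h1 hc.le
  have r2 := mul_le_mul_of_nonneg_left h2 (by positivity : 0 ≤ 2 * m)
  have r3 := mul_le_mul_of_nonneg_left h3 (by positivity : 0 ≤ 2 * m)
  nlinarith

end Young

/-! ### The energy estimate for smooth subsolutions -/

/-- Exponents for the energy estimate with test function `w ^ (s - 1) * η ^ (2 * m)`. -/
structure EnergyExponents (d : ℕ) (s r θ q N : ℝ) (m : ℕ) : Prop where
  two_lt : 2 < d
  one_le_m : 1 ≤ m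
  one_lt_s : 1 < s
  q_pos : 0 < q
  q_le : q ≤ θ
  θ_lt : θ < ((d : ℝ) - 2) / d
  s_eq : s = (1 - θ) + r * θ
  s_sub_one : s - 1 = r * q
  r_eq : s / 2 * (2 * d / (d - 2)) = r
  N_eq : m * (2 * d / ((d : ℝ) - 2)) = N
  Nθ_le : N * θ ≤ 2 * m - 2
  Nq_le : N * q ≤ 2 * m

set_option maxHeartbeats 1000000 in
/-- The energy estimate for smooth positive subsolutions of `-Δw + div F ≤ g`. -/
theorem exists_energy_bound {d : ℕ} {s r θ q N : ℝ} {m : ℕ}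
    (hex : EnergyExponents d s r θ q N m)
    {U : Set (EuclideanSpace ℝ (Fin d))} (hU : IsCompact U)
    {η : EuclideanSpace ℝ (Fin d) → ℝ} (hη : ContDiff ℝ ∞ η) (hη0 : ∀ x, 0 ≤ η x)
    (hη1 : ∀ x, η x ≤ 1) (hηU : tsupport η ⊆ U) {κ : ℝ} (hκ : 0 ≤ κ) :
    ∃ C : ℝ, 0 ≤ C ∧ ∀ (w g B G : EuclideanSpace ℝ (Fin d) → ℝ)
      (F : EuclideanSpace ℝ (Fin d) → EuclideanSpace ℝ (Fin d)),
      ContDiff ℝ ∞ w → (∀ x, 0 < w x) → Continuous F → Continuous g →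
      (∀ x, 0 ≤ B x) → (∀ x, 0 ≤ G x) → IntegrableOn B U → IntegrableOn G U →
      ∫ x in U, B x ≤ 1 → ∫ x in U, G x ≤ 1 → ∫ x in U, w x ≤ κ →
      (∀ x ∈ U, ‖F x‖ ^ 2 ≤ B x ^ (1 - θ) * w x ^ (1 + θ)) →
      (∀ x ∈ U, |g x| ≤ G x ^ (1 - q)) →
      (∀ φ, IsTestFn U φ → (∀ x, 0 ≤ φ x) →
        ∫ x, inner ℝ (gradient w x) (gradient φ x) ≤
          (∫ x, inner ℝ (F x) (gradient φ x)) + ∫ x, g x * φ x) →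
      ∫ x in U, w x ^ r * η x ^ N ≤ C ∧
      ∫ x in U, w x ^ (s - 2) * η x ^ (2 * m) * ‖gradient w x‖ ^ 2 ≤ C := by
  obtain ⟨hd, hm, hs, hq0, hqθ, hθβ, e1, e2, e3, e4, n1, n2⟩ := hex
  have hd' : (2 : ℝ) < d := by exact_mod_cast hd
  have hm' : (1 : ℝ) ≤ m := by exact_mod_cast hm
  have hθ0 : 0 < θ := hq0.trans_le hqθ
  have hβ1 : ((d : ℝ) - 2) / d < 1 := by rw [div_lt_one (by linarith)]; linarith
  have hθ1 : θ < 1 := hθβ.trans hβ1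
  have ht0 : 0 < 2 * d / ((d : ℝ) - 2) := div_pos (by linarith) (by linarith)
  have hN0 : 0 < N := by rw [← e4]; positivity
  have hr0 : 0 < r := by rw [← e3]; positivity
  have hηc : HasCompactSupport η := hU.of_isClosed_subset (isClosed_tsupport _) hηU
  have hgc : HasCompactSupport (gradient η) := by
    refine HasCompactSupport.intro hηc fun x hx => gradient_eq_zero_of_notMem_tsupport hx
  obtain ⟨L, hL⟩ := hη.continuous_gradient.bounded_above_of_compact_support hgc
  obtain ⟨CS, hCS0, hCS⟩ := exists_sobolev_integral d hd
  -- `c1` will multiply I^θ in the tested inequality, `c2` bounds the energy by I^θ + I^q, and `c3`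
  -- does the same for I^((d-2)/d) after Sobolev. None involves w, F or g.
  set c1 : ℝ := (s - 1 + m) + (4 * m ^ 2 / (s - 1) + m) * (L ^ 2 * κ ^ (1 - θ)) with hc1
  have hs1 : 0 < s - 1 := by linarith
  have hc10 : 0 ≤ c1 := by positivity
  set c2 : ℝ := 2 / (s - 1) * (c1 + 1) with hc2
  have hc20 : 0 ≤ c2 := by positivity
  set c3 : ℝ := CS * (s ^ 2 / 2 * c2 + 2 * m ^ 2 * (L ^ 2 * κ ^ (1 - θ))) with hc3
  have hc30 : 0 ≤ c3 := by positivity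
  obtain ⟨C1, hC11, hC1⟩ := exists_bound_of_rpow_le hqθ hθβ hc30
  refine ⟨C1 + c2 * (C1 ^ θ + C1 ^ q), by positivity, ?_⟩
  intro w g B G F hw hwpos hF hg hB0 hG0 hBi hGi hB hG hwκ hFB hgG heq
  have hwd : ∀ x, DifferentiableAt ℝ w x := fun x => hw.differentiable (by simp) x
  have hηd : ∀ x, DifferentiableAt ℝ η x := fun x => hη.differentiable (by simp) x
  have hwrc : ∀ α : ℝ, Continuous fun x => w x ^ α := fun α =>
    hw.continuous.rpow_const fun x => Or.inl (hwpos x).ne'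
  have hη_out : ∀ x ∉ U, η x = 0 := fun x hx => image_eq_zero_of_notMem_tsupport fun h => hx (hηU h)
  have hgη_out : ∀ x ∉ U, gradient η x = 0 := fun x hx =>
    gradient_eq_zero_of_notMem_tsupport fun h => hx (hηU h)
  have hm0 : m ≠ 0 := by omega
  -- the three vector fields of the energy identity
  set a : EuclideanSpace ℝ (Fin d) → EuclideanSpace ℝ (Fin d) :=
    fun x => (w x ^ ((s - 2) / 2) * η x ^ m) • gradient w x with ha
  set f : EuclideanSpace ℝ (Fin d) → EuclideanSpace ℝ (Fin d) :=
    fun x => (w x ^ ((s - 2) / 2) * η x ^ m) • F x with hf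
  set h : EuclideanSpace ℝ (Fin d) → EuclideanSpace ℝ (Fin d) :=
    fun x => (w x ^ (s / 2) * η x ^ (m - 1)) • gradient η x with hh
  have hac : Continuous a := ((hwrc _).mul (hη.continuous.pow _)).smul hw.continuous_gradient
  have hfc : Continuous f := ((hwrc _).mul (hη.continuous.pow _)).smul hF
  have hhc : Continuous h := ((hwrc _).mul (hη.continuous.pow _)).smul hη.continuous_gradient
  have ha_out : ∀ x ∉ U, a x = 0 := fun x hx => by simp [ha, hη_out x hx, hm0]
  have hf_out : ∀ x ∉ U, f x = 0 := fun x hx => by simp [hf, hη_out x hx, hm0]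
  have hh_out : ∀ x ∉ U, h x = 0 := fun x hx => by simp [hh, hgη_out x hx]
  have hint : ∀ {u : EuclideanSpace ℝ (Fin d) → ℝ}, Continuous u → (∀ x ∉ U, u x = 0) →
      Integrable u := fun hu h0 =>
    hu.integrable_of_hasCompactSupport (HasCompactSupport.intro hU h0)
  have hset : ∀ {u : EuclideanSpace ℝ (Fin d) → ℝ}, (∀ x ∉ U, u x = 0) →
      ∫ x in U, u x = ∫ x, u x := fun h0 => setIntegral_eq_integral_of_forall_compl_eq_zero h0
  -- the test function
  set φ : EuclideanSpace ℝ (Fin d) → ℝ := fun x => w x ^ (s - 1) * η x ^ (2 * m) with hφ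
  have hφ0 : ∀ x, 0 ≤ φ x := fun x =>
    mul_nonneg (Real.rpow_nonneg (hwpos x).le _) (pow_nonneg (hη0 x) _)
  have hφs : ContDiff ℝ ∞ φ :=
    (hw.rpow_const_of_ne fun x => (hwpos x).ne').mul (hη.pow _)
  have hφsupp : tsupport φ ⊆ U := by
    refine closure_minimal (fun x hx => ?_) hU.isClosed
    by_contra hxU
    exact hx (by simp [hφ, hη_out x hxU, hm0])
  have hφtest : IsTestFn U φ :=
    ⟨hφs, hU.of_isClosed_subset (isClosed_tsupport _) hφsupp, hφsupp⟩
  have hφ_out : ∀ x ∉ U, φ x = 0 := fun x hx => image_eq_zero_of_notMem_tsupport fun h => hx (hφsupp h)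
  have hgφ_out : ∀ x ∉ U, gradient φ x = 0 := fun x hx =>
    gradient_eq_zero_of_notMem_tsupport fun h => hx (hφsupp h)
  have hwork := heq φ hφtest hφ0
  -- Splitting the powers of w and η in ∇φ evenly between the two factors writes the tested equation
  -- in terms of a, f, h alone, the form that `young_energy` takes.
  have hinner : ∀ x, inner ℝ (gradient w x) (gradient φ x) - inner ℝ (F x) (gradient φ x) =
      (s - 1) * inner ℝ (a x - f x) (a x) + 2 * m * inner ℝ (a x - f x) (h x) := by
    intro x
    have hgrad := (hasGradientAt_rpow_mul_pow (hwd x) (hηd x) (hwpos x) (s - 1) (2 * m)).gradient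
    have p1 : w x ^ (s - 1 - 1) = w x ^ ((s - 2) / 2) * w x ^ ((s - 2) / 2) := by
      rw [← Real.rpow_add (hwpos x)]; ring_nf
    have p2 : w x ^ (s - 1) = w x ^ ((s - 2) / 2) * w x ^ (s / 2) := by
      rw [← Real.rpow_add (hwpos x)]; ring_nf
    have p3 : η x ^ (2 * m - 1) = η x ^ m * η x ^ (m - 1) := by
      rw [← pow_add]; congr 1; omega
    have p4 : η x ^ (2 * m) = η x ^ m * η x ^ m := by rw [← pow_add]; congr 1; omega
    rw [← inner_sub_left, hgrad, ha, hf, hh]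
    simp only [← smul_sub, inner_add_right, real_inner_smul_left, real_inner_smul_right]
    rw [p1, p2, p3, p4]
    push_cast
    ring
  have i1 : Integrable fun x => inner ℝ (gradient w x) (gradient φ x) :=
    hint (hw.continuous_gradient.inner hφs.continuous_gradient)
      fun x hx => by simp [hgφ_out x hx]
  have i2 : Integrable fun x => inner ℝ (F x) (gradient φ x) :=
    hint (hF.inner hφs.continuous_gradient) fun x hx => by simp [hgφ_out x hx]
  have ia : Integrable fun x => ‖a x‖ ^ 2 :=
    hint (hac.norm.pow 2) fun x hx => by simp [ha_out x hx]
  have iF : Integrable fun x => ‖f x‖ ^ 2 :=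
    hint (hfc.norm.pow 2) fun x hx => by simp [hf_out x hx]
  have ih : Integrable fun x => ‖h x‖ ^ 2 :=
    hint (hhc.norm.pow 2) fun x hx => by simp [hh_out x hx]
  have ig : Integrable fun x => g x * φ x :=
    hint (hg.mul hφs.continuous) fun x hx => by simp [hφ_out x hx]
  -- the weight
  set Z : EuclideanSpace ℝ (Fin d) → ℝ := fun x => w x ^ r * η x ^ N with hZ
  have hZ0 : ∀ x, 0 ≤ Z x := fun x =>
    mul_nonneg (Real.rpow_nonneg (hwpos x).le _) (Real.rpow_nonneg (hη0 x) _)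
  have hZc : Continuous Z := (hwrc _).mul (hη.continuous.rpow_const fun x => Or.inr hN0.le)
  have hZ_out : ∀ x ∉ U, Z x = 0 := fun x hx => by
    simp [hZ, hη_out x hx, Real.zero_rpow hN0.ne']
  have iZ : Integrable Z := hint hZc hZ_out
  set I : ℝ := ∫ x in U, Z x with hI
  have hI0 : 0 ≤ I := integral_nonneg hZ0
  -- As 0 ≤ η ≤ 1, lowering its exponent from j to N e only increases the weight; the bounds on N θ
  -- and N q in `EnergyExponents` provide N e ≤ j.
  have hZpow : ∀ x (e : ℝ) (j : ℕ), N * e ≤ j → 0 ≤ N * e →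
      w x ^ (r * e) * η x ^ j ≤ Z x ^ e := by
    intro x e j hj hj0
    rw [hZ]
    simp only
    rw [Real.mul_rpow (Real.rpow_nonneg (hwpos x).le _) (Real.rpow_nonneg (hη0 x) _),
      ← Real.rpow_mul (hwpos x).le, ← Real.rpow_mul (hη0 x), ← Real.rpow_natCast]
    exact mul_le_mul_of_nonneg_left
      (Real.rpow_le_rpow_of_exponent_ge_of_imp (hη0 x) (hη1 x) hj
        (fun _ h0 => by rw [h0] at hj; exact le_antisymm hj hj0)) (Real.rpow_nonneg (hwpos x).le _)
  have hU' : MeasurableSet U := hU.isClosed.measurableSet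
  -- the drift term
  have hBZ := integral_rpow_mul_rpow_le (μ := volume.restrict U) (.of_forall hB0) (.of_forall hZ0)
    hBi iZ.integrableOn (sub_pos.2 hθ1) hθ0 (by ring)
  have bf : ∫ x, ‖f x‖ ^ 2 ≤ I ^ θ := by
    rw [← hset (fun x hx => by simp [hf_out x hx])]
    refine (setIntegral_mono_on iF.integrableOn hBZ.1 hU' fun x hx => ?_).trans (hBZ.2.trans ?_)
    · have hx1 := hZpow x θ (2 * m) (by push_cast; linarith) (by positivity)
      rw [hf]
      simp only
      rw [norm_smul, mul_pow, Real.norm_of_nonneg (mul_nonneg (Real.rpow_nonneg (hwpos x).le _)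
        (pow_nonneg (hη0 x) _)), mul_pow, ← pow_mul, mul_comm m 2, ← Real.rpow_mul_natCast
        (hwpos x).le]
      calc w x ^ ((s - 2) / 2 * (2 : ℕ)) * η x ^ (2 * m) * ‖F x‖ ^ 2
          ≤ w x ^ ((s - 2) / 2 * (2 : ℕ)) * η x ^ (2 * m)
              * (B x ^ (1 - θ) * w x ^ (1 + θ)) :=
            mul_le_mul_of_nonneg_left (hFB x hx) (mul_nonneg (Real.rpow_nonneg (hwpos x).le _)
              (pow_nonneg (hη0 x) _))
        _ = B x ^ (1 - θ) * (w x ^ (r * θ) * η x ^ (2 * m)) := by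
            have : w x ^ (r * θ) = w x ^ ((s - 2) / 2 * (2 : ℕ)) * w x ^ (1 + θ) := by
              rw [← Real.rpow_add (hwpos x)]; congr 1; push_cast; linarith
            rw [this]; ring
        _ ≤ _ := mul_le_mul_of_nonneg_left hx1 (Real.rpow_nonneg (hB0 x) _)
    · exact mul_le_of_le_one_left (Real.rpow_nonneg hI0 _)
        (Real.rpow_le_one (integral_nonneg hB0) hB (sub_pos.2 hθ1).le)
  -- the cutoff term
  have hwZ := integral_rpow_mul_rpow_le (μ := volume.restrict U)
    (.of_forall fun x => (hwpos x).le) (.of_forall hZ0)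
    (hw.continuous.continuousOn.integrableOn_compact hU) iZ.integrableOn
    (sub_pos.2 hθ1) hθ0 (by ring)
  have bh : ∫ x, ‖h x‖ ^ 2 ≤ L ^ 2 * κ ^ (1 - θ) * I ^ θ := by
    rw [← hset (fun x hx => by simp [hh_out x hx])]
    refine (setIntegral_mono_on ih.integrableOn (hwZ.1.const_mul (L ^ 2)) hU'
      fun x hx => ?_).trans ?_
    -- Differentiating the cutoff costs one power of η in h, hence two in ‖h‖²; this is why N θ ≤ 2m
    -- - 2 is required.
    · have hx1 := hZpow x θ (2 * (m - 1))
        (by push_cast [Nat.cast_sub hm]; linarith) (by positivity)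
      rw [hh]
      simp only
      rw [norm_smul, mul_pow, Real.norm_of_nonneg (mul_nonneg (Real.rpow_nonneg (hwpos x).le _)
        (pow_nonneg (hη0 x) _)), mul_pow, ← pow_mul, mul_comm (m - 1) 2, ← Real.rpow_mul_natCast
        (hwpos x).le]
      have e : w x ^ (s / 2 * (2 : ℕ)) = w x ^ (1 - θ) * w x ^ (r * θ) := by
        rw [← Real.rpow_add (hwpos x)]; congr 1; push_cast; linarith
      rw [e, mul_comm]
      refine mul_le_mul (pow_le_pow_left₀ (norm_nonneg _) (hL x) 2) ?_ (by
        have := hη0 x; have := (hwpos x).le; positivity) (sq_nonneg _)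
      rw [mul_assoc]
      exact mul_le_mul_of_nonneg_left hx1 (Real.rpow_nonneg (hwpos x).le _)
    · rw [integral_const_mul, mul_assoc]
      refine mul_le_mul_of_nonneg_left (hwZ.2.trans ?_) (sq_nonneg _)
      exact mul_le_mul_of_nonneg_right (Real.rpow_le_rpow (integral_nonneg fun x => (hwpos x).le)
        hwκ (sub_pos.2 hθ1).le) (Real.rpow_nonneg hI0 _)
  -- the source term
  have hq1 : 0 < 1 - q := by linarith
  have hGZ := integral_rpow_mul_rpow_le (μ := volume.restrict U) (.of_forall hG0) (.of_forall hZ0)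
    hGi iZ.integrableOn hq1 hq0 (by ring)
  have bg : ∫ x, g x * φ x ≤ I ^ q := by
    rw [← hset (fun x hx => by simp [hφ_out x hx])]
    refine (setIntegral_mono_on ig.integrableOn hGZ.1 hU' fun x hx => ?_).trans (hGZ.2.trans ?_)
    · have hx1 := hZpow x q (2 * m) (by push_cast; linarith) (by positivity)
      rw [← e2] at hx1
      calc g x * φ x ≤ |g x| * φ x := mul_le_mul_of_nonneg_right (le_abs_self _) (hφ0 x)
        _ ≤ _ := mul_le_mul (hgG x hx) hx1 (hφ0 x) (Real.rpow_nonneg (hG0 x) _)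
    · exact mul_le_of_le_one_left (Real.rpow_nonneg hI0 _)
        (Real.rpow_le_one (integral_nonneg hG0) hG hq1.le)
  -- energy estimate
  have hE : ∫ x, ‖a x‖ ^ 2 ≤ c2 * (I ^ θ + I ^ q) := by
    have j1 : Integrable fun x =>
        inner ℝ (gradient w x) (gradient φ x) - inner ℝ (F x) (gradient φ x) := i1.sub i2
    have j2 : Integrable fun x =>
        inner ℝ (gradient w x) (gradient φ x) - inner ℝ (F x) (gradient φ x)
          + (s - 1 + m) * ‖f x‖ ^ 2 := j1.add (iF.const_mul _)
    have hy : ∫ x, (s - 1) / 2 * ‖a x‖ ^ 2 ≤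
        ∫ x, ((inner ℝ (gradient w x) (gradient φ x) - inner ℝ (F x) (gradient φ x))
          + (s - 1 + m) * ‖f x‖ ^ 2 + (4 * m ^ 2 / (s - 1) + m) * ‖h x‖ ^ 2) := by
      refine integral_mono (ia.const_mul _) (j2.add (ih.const_mul _)) fun x => ?_
      have := young_energy (a x) (f x) (h x) hs1 (by positivity : (0 : ℝ) ≤ m)
      simp only
      rw [hinner x]
      exact this
    rw [integral_const_mul, integral_add j2 (ih.const_mul _),
      integral_add j1 (iF.const_mul _), integral_sub i1 i2, integral_const_mul,
      integral_const_mul] at hy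
    have t1 := mul_le_mul_of_nonneg_left bf (by positivity : 0 ≤ s - 1 + m)
    have t2 := mul_le_mul_of_nonneg_left bh (by positivity : 0 ≤ 4 * m ^ 2 / (s - 1) + m)
    have hb : (s - 1) / 2 * ∫ x, ‖a x‖ ^ 2 ≤ c1 * I ^ θ + I ^ q := by
      rw [hc1]; linarith
    have hIθ : 0 ≤ I ^ θ := Real.rpow_nonneg hI0 _
    have hIq : 0 ≤ I ^ q := Real.rpow_nonneg hI0 _
    have : ∫ x, ‖a x‖ ^ 2 = 2 / (s - 1) * ((s - 1) / 2 * ∫ x, ‖a x‖ ^ 2) := by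
      field_simp
    rw [this, hc2, mul_assoc]
    refine mul_le_mul_of_nonneg_left ?_ (by positivity)
    linarith [mul_nonneg hc10 hIq]
  -- Sobolev inequality
  set v : EuclideanSpace ℝ (Fin d) → ℝ := fun x => w x ^ (s / 2) * η x ^ m with hv
  have hvs : ContDiff ℝ ∞ v := (hw.rpow_const_of_ne fun x => (hwpos x).ne').mul (hη.pow _)
  have hvc : HasCompactSupport v :=
    HasCompactSupport.intro hU fun x hx => by simp [hv, hη_out x hx, hm0]
  have hvZ : ∀ x, |v x| ^ (2 * d / (d - 2) : ℝ) = Z x := fun x => by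
    have h1 := (hwpos x).le
    have h2 := hη0 x
    rw [abs_of_nonneg (by positivity), hv]
    simp only
    rw [Real.mul_rpow (by positivity) (by positivity), ← Real.rpow_mul h1, ← Real.rpow_natCast,
      ← Real.rpow_mul h2, e3, e4]
  have hvgrad : ∀ x, ‖gradient v x‖ ^ 2 ≤ s ^ 2 / 2 * ‖a x‖ ^ 2 + 2 * m ^ 2 * ‖h x‖ ^ 2 := by
    intro x
    have hgr : gradient v x = (s / 2) • a x + (m : ℝ) • h x := by
      rw [(hasGradientAt_rpow_mul_pow (hwd x) (hηd x) (hwpos x) (s / 2) m).gradient, ha, hh]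
      simp only [smul_smul]
      rw [show s / 2 - 1 = (s - 2) / 2 by ring]
      congr 2 <;> ring
    rw [hgr]
    have := pow_le_pow_left₀ (norm_nonneg _) (norm_add_le ((s / 2) • a x) ((m : ℝ) • h x)) 2
    rw [norm_smul (s / 2) (a x), norm_smul (m : ℝ) (h x),
      Real.norm_of_nonneg (by positivity : 0 ≤ s / 2),
      Real.norm_of_nonneg (by positivity : (0 : ℝ) ≤ m)] at this
    linarith [sq_nonneg (s / 2 * ‖a x‖ - m * ‖h x‖)]
  have hsob := hCS v hvs hvc
  simp_rw [hvZ] at hsob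
  rw [← hset hZ_out, ← hI] at hsob
  have iv : Integrable fun x => ‖gradient v x‖ ^ 2 :=
    hint (hvs.continuous_gradient.norm.pow 2) fun x hx => by
      rw [gradient_eq_zero_of_notMem_tsupport]
      · simp
      · exact fun h => hx (closure_minimal (fun y hy => by
          by_contra hyU
          exact hy (by simp [hv, hη_out y hyU, hm0])) hU.isClosed h)
  have hvint : ∫ x, ‖gradient v x‖ ^ 2 ≤
      (s ^ 2 / 2 * ∫ x, ‖a x‖ ^ 2) + 2 * m ^ 2 * ∫ x, ‖h x‖ ^ 2 := by
    refine (integral_mono iv ((ia.const_mul _).add (ih.const_mul _)) hvgrad).trans_eq ?_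
    simp only [Pi.add_apply]
    rw [integral_add (ia.const_mul _) (ih.const_mul _), integral_const_mul, integral_const_mul]
  have hIθ : 0 ≤ I ^ θ := Real.rpow_nonneg hI0 _
  have hIq : 0 ≤ I ^ q := Real.rpow_nonneg hI0 _
  -- I is a finite real number because w is smooth and U compact, so it can be absorbed.
  have hfin : I ^ (((d : ℝ) - 2) / d) ≤ c3 * (I ^ θ + I ^ q) := by
    refine hsob.trans ?_
    rw [hc3, mul_assoc]
    refine mul_le_mul_of_nonneg_left (hvint.trans ?_) hCS0
    have t1 := mul_le_mul_of_nonneg_left hE (by positivity : 0 ≤ s ^ 2 / 2)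
    have t2 := mul_le_mul_of_nonneg_left bh (by positivity : (0 : ℝ) ≤ 2 * m ^ 2)
    have t3 : 0 ≤ 2 * m ^ 2 * (L ^ 2 * κ ^ (1 - θ)) * I ^ q := by positivity
    linarith
  have hIC := hC1 I hfin
  have hmono : c2 * (I ^ θ + I ^ q) ≤ c2 * (C1 ^ θ + C1 ^ q) :=
    mul_le_mul_of_nonneg_left (add_le_add (Real.rpow_le_rpow hI0 hIC hθ0.le)
      (Real.rpow_le_rpow hI0 hIC hq0.le)) hc20
  refine ⟨hIC.trans (le_add_of_nonneg_right (by positivity)), ?_⟩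
  have hae : ∀ x, w x ^ (s - 2) * η x ^ (2 * m) * ‖gradient w x‖ ^ 2 = ‖a x‖ ^ 2 := fun x => by
    rw [ha]
    simp only
    rw [norm_smul, mul_pow, Real.norm_of_nonneg (mul_nonneg (Real.rpow_nonneg (hwpos x).le _)
        (pow_nonneg (hη0 x) _)), mul_pow, ← pow_mul, mul_comm m 2, ← Real.rpow_mul_natCast
        (hwpos x).le]
    congr 3
    push_cast; ring
  simp_rw [hae]
  rw [hset fun x hx => by simp [ha_out x hx]]
  linarith

/-! ### From weighted energies to norms -/

theorem eLpNorm_le_of_setIntegral_rpow_norm_le {X F : Type*} [TopologicalSpace X] [T2Space X]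
    [MeasurableSpace X] [BorelSpace X] [SecondCountableTopology X]
    [NormedAddCommGroup F] {μ : Measure X} [IsFiniteMeasureOnCompacts μ]
    {f : X → F} (hf : Continuous f) {U V : Set X} (hU : IsCompact U)
    (hVU : V ⊆ U) {p C : ℝ} (hp : 0 < p) (h : ∫ x in V, ‖f x‖ ^ p ∂μ ≤ C) :
    eLpNorm f (ENNReal.ofReal p) (μ.restrict V) ≤ ENNReal.ofReal (C ^ (1 / p)) := by
  have hi : IntegrableOn (fun x => ‖f x‖ ^ p) V μ :=
    ((hf.norm.rpow_const fun x => Or.inr hp.le).continuousOn.integrableOn_compact hU).mono_set hVU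
  have hp0 : ENNReal.ofReal p ≠ 0 := by simpa using hp
  rw [eLpNorm_eq_lintegral_rpow_enorm_toReal hp0 ENNReal.ofReal_ne_top,
    ENNReal.toReal_ofReal hp.le, ← ENNReal.ofReal_rpow_of_nonneg
      ((integral_nonneg fun x => by positivity).trans h) (by positivity)]
  refine ENNReal.rpow_le_rpow ?_ (by positivity)
  refine le_trans (le_of_eq ?_) (ENNReal.ofReal_le_ofReal h)
  rw [ofReal_integral_eq_lintegral_ofReal hi (.of_forall fun x => by positivity)]
  refine lintegral_congr fun x => ?_
  rw [← ofReal_norm, ENNReal.ofReal_rpow_of_nonneg (norm_nonneg _) hp.le]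

/-- Where η = 1, |∇w|^τ is the product of the energy density to the power τ/2 and w^r to the power 1
- τ/2: the relation between τ, s and r says exactly that the powers of w cancel. Hölder concludes.
-/
theorem eLpNorm_le_of_energy_le {d : ℕ} {s r τ N C : ℝ} {m : ℕ}
    {U V : Set (EuclideanSpace ℝ (Fin d))} {η w : EuclideanSpace ℝ (Fin d) → ℝ}
    (hr : 0 < r) (hτ0 : 0 < τ) (hτ2 : τ < 2) (hτ : (2 - s) * (τ / 2) = r * (1 - τ / 2))
    (hN : 0 ≤ N) (hU : IsCompact U) (hV : MeasurableSet V) (hVU : V ⊆ U)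
    (hη : Continuous η) (hη0 : ∀ x, 0 ≤ η x) (hη1 : ∀ x ∈ V, η x = 1)
    (hw : ContDiff ℝ ∞ w) (hw0 : ∀ x, 0 < w x) (hC : 0 ≤ C)
    (h1 : ∫ x in U, w x ^ r * η x ^ N ≤ C)
    (h2 : ∫ x in U, w x ^ (s - 2) * η x ^ (2 * m) * ‖gradient w x‖ ^ 2 ≤ C) :
    eLpNorm w (ENNReal.ofReal r) (volume.restrict V) ≤ ENNReal.ofReal (C ^ (1 / r)) ∧
      eLpNorm (gradient w) (ENNReal.ofReal τ) (volume.restrict V) ≤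
        ENNReal.ofReal (C ^ (1 / τ)) := by
  have hrc : ∀ α : ℝ, Continuous fun x => w x ^ α := fun α =>
    hw.continuous.rpow_const fun x => Or.inl (hw0 x).ne'
  set Z : EuclideanSpace ℝ (Fin d) → ℝ := fun x => w x ^ r * η x ^ N with hZ
  set A : EuclideanSpace ℝ (Fin d) → ℝ :=
    fun x => w x ^ (s - 2) * η x ^ (2 * m) * ‖gradient w x‖ ^ 2 with hA
  have hZ0 : ∀ x, 0 ≤ Z x := fun x =>
    mul_nonneg (Real.rpow_nonneg (hw0 x).le _) (Real.rpow_nonneg (hη0 x) _)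
  have hA0 : ∀ x, 0 ≤ A x := fun x => mul_nonneg
    (mul_nonneg (Real.rpow_nonneg (hw0 x).le _) (pow_nonneg (hη0 x) _)) (sq_nonneg _)
  have iZ : IntegrableOn Z U := ((hrc r).mul
    (hη.rpow_const fun x => Or.inr hN)).continuousOn.integrableOn_compact hU
  have iA : IntegrableOn A U := (((hrc _).mul (hη.pow _)).mul
    (hw.continuous_gradient.norm.pow 2)).continuousOn.integrableOn_compact hU
  constructor
  · refine eLpNorm_le_of_setIntegral_rpow_norm_le hw.continuous hU hVU hr (le_trans ?_ h1)
    refine le_trans (le_of_eq (setIntegral_congr_fun hV fun x hx => ?_))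
      (setIntegral_mono_set iZ (.of_forall hZ0) hVU.eventuallyLE)
    simp [hη1 x hx, abs_of_pos (hw0 x)]
  · refine eLpNorm_le_of_setIntegral_rpow_norm_le hw.continuous_gradient hU hVU hτ0 ?_
    have hH := integral_rpow_mul_rpow_le (μ := volume.restrict U) (.of_forall hA0) (.of_forall hZ0)
      iA iZ (by linarith : 0 < τ / 2) (by linarith : 0 < 1 - τ / 2) (by ring)
    have e : ∫ x in V, ‖gradient w x‖ ^ τ = ∫ x in V, A x ^ (τ / 2) * Z x ^ (1 - τ / 2) := by
      refine setIntegral_congr_fun hV fun x hx => ?_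
      have hw' := (hw0 x).le
      simp only [hA, hZ, hη1 x hx, one_pow, Real.one_rpow, mul_one]
      rw [Real.mul_rpow (by positivity) (by positivity), ← Real.rpow_mul hw', ← Real.rpow_mul hw',
        mul_right_comm, ← Real.rpow_add (hw0 x), ← Real.rpow_natCast, ← Real.rpow_mul (by positivity)]
      rw [show (s - 2) * (τ / 2) + r * (1 - τ / 2) = 0 by linarith, Real.rpow_zero, one_mul]
      congr 1
      push_cast
      ring
    rw [e]
    refine (setIntegral_mono_set hH.1 (.of_forall fun x => mul_nonneg (Real.rpow_nonneg (hA0 x) _)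
      (Real.rpow_nonneg (hZ0 x) _)) hVU.eventuallyLE).trans (hH.2.trans ?_)
    calc _ ≤ C ^ (τ / 2) * C ^ (1 - τ / 2) :=
          mul_le_mul (Real.rpow_le_rpow (integral_nonneg hA0) h2 (by linarith))
            (Real.rpow_le_rpow (integral_nonneg hZ0) h1 (by linarith))
            (Real.rpow_nonneg (integral_nonneg hZ0) _) (Real.rpow_nonneg hC _)
      _ = C := by
          rw [← Real.rpow_add' hC (by norm_num)]
          norm_num

/-! ### Mollification -/

section Mollify

open Filter Topology
open scoped Convolution

variable {d : ℕ} {F : Type*} [NormedAddCommGroup F] [NormedSpace ℝ F]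

/-- Mollification of `f` by the normalized bump function `χ`. -/
noncomputable def mollify (χ : ContDiffBump (0 : EuclideanSpace ℝ (Fin d)))
    (f : EuclideanSpace ℝ (Fin d) → F) (x : EuclideanSpace ℝ (Fin d)) : F :=
  ∫ y, χ.normed volume (x - y) • f y

variable (χ : ContDiffBump (0 : EuclideanSpace ℝ (Fin d)))

theorem mollify_eq_convolution (f : EuclideanSpace ℝ (Fin d) → F) :
    mollify χ f = χ.normed volume ⋆[ContinuousLinearMap.lsmul ℝ ℝ, volume] f := by
  ext x
  rw [convolution_eq_swap]
  rfl

theorem ContDiffBump.normed_eq_zero {z : EuclideanSpace ℝ (Fin d)} (hz : χ.rOut ≤ ‖z‖) :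
    χ.normed volume z = 0 := by
  by_contra h
  have : z ∈ Function.support (χ.normed volume) := h
  rw [χ.support_normed_eq] at this
  simp at this
  linarith

theorem ContDiffBump.exists_normed_le : ∃ M : ℝ, 0 ≤ M ∧ ∀ z, χ.normed volume z ≤ M := by
  obtain ⟨M, hM⟩ := (χ.continuous_normed (μ := volume)).bounded_above_of_compact_support
    χ.hasCompactSupport_normed
  exact ⟨M, (norm_nonneg _).trans (hM 0), fun z => (le_abs_self _).trans (hM z)⟩

variable {χ}

theorem integrable_normed_smul {f : EuclideanSpace ℝ (Fin d) → F} (hf : Integrable f)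
    (x : EuclideanSpace ℝ (Fin d)) : Integrable fun y => χ.normed volume (x - y) • f y := by
  obtain ⟨M, -, hM⟩ := χ.exists_normed_le
  refine hf.bdd_smul M ((χ.continuous_normed.comp
    (continuous_const.sub continuous_id)).aestronglyMeasurable) (.of_forall fun y => ?_)
  rw [Real.norm_of_nonneg (χ.nonneg_normed _)]
  exact hM _

theorem contDiff_mollify {f : EuclideanSpace ℝ (Fin d) → F} [CompleteSpace F]
    (hf : LocallyIntegrable f) : ContDiff ℝ ∞ (mollify χ f) := by
  rw [mollify_eq_convolution]
  exact χ.hasCompactSupport_normed.contDiff_convolution_left _ χ.contDiff_normed hf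

theorem mollify_nonneg {f : EuclideanSpace ℝ (Fin d) → ℝ} (hf : 0 ≤ᵐ[volume] f)
    (x : EuclideanSpace ℝ (Fin d)) : 0 ≤ mollify χ f x :=
  integral_nonneg_of_ae (hf.mono fun _ hy => mul_nonneg (χ.nonneg_normed _) hy)

theorem integrable_mollify {f : EuclideanSpace ℝ (Fin d) → ℝ} (hf : Integrable f) :
    Integrable (mollify χ f) := by
  rw [mollify_eq_convolution]
  exact (χ.integrable_normed).integrable_convolution _ hf

theorem integral_mollify {f : EuclideanSpace ℝ (Fin d) → ℝ} (hf : Integrable f) :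
    ∫ x, mollify χ f x = ∫ x, f x := by
  rw [mollify_eq_convolution, integral_convolution _ χ.integrable_normed hf, χ.integral_normed]
  simp

/-- Jensen's inequality for mollifications. -/
theorem norm_mollify_le {f : EuclideanSpace ℝ (Fin d) → F} {a c : EuclideanSpace ℝ (Fin d) → ℝ}
    (ha : Integrable a) (hc : Integrable c)
    (ha0 : 0 ≤ᵐ[volume] a) (hc0 : 0 ≤ᵐ[volume] c) {α β : ℝ} (hα : 0 < α) (hβ : 0 < β)
    (hαβ : α + β = 1) (h : ∀ᵐ x, ‖f x‖ ≤ a x ^ α * c x ^ β) (x : EuclideanSpace ℝ (Fin d)) :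
    ‖mollify χ f x‖ ≤ mollify χ a x ^ α * mollify χ c x ^ β := by
  have hH := integral_rpow_mul_rpow_le (μ := volume)
    (f := fun y => χ.normed volume (x - y) • a y) (g := fun y => χ.normed volume (x - y) • c y)
    (ha0.mono fun _ hy => mul_nonneg (χ.nonneg_normed _) hy)
    (hc0.mono fun _ hy => mul_nonneg (χ.nonneg_normed _) hy)
    (integrable_normed_smul ha x) (integrable_normed_smul hc x) hα hβ hαβ
  refine (norm_integral_le_of_norm_le hH.1 ?_).trans hH.2
  filter_upwards [h, ha0, hc0] with y hy ha hc
  have hχ := χ.nonneg_normed (μ := volume) (x - y)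
  rw [norm_smul, Real.norm_of_nonneg hχ, smul_eq_mul, smul_eq_mul, Real.mul_rpow hχ ha,
    Real.mul_rpow hχ hc, mul_mul_mul_comm, ← Real.rpow_add' hχ (by rw [hαβ]; norm_num), hαβ,
    Real.rpow_one]
  exact mul_le_mul_of_nonneg_left hy hχ

/-- Supplies the second factor in Jensen's inequality for the source, which is compared with the
constant 1 on K. -/
theorem mollify_indicator_one_le {K : Set (EuclideanSpace ℝ (Fin d))}
    (x : EuclideanSpace ℝ (Fin d)) : mollify χ (K.indicator fun _ => (1 : ℝ)) x ≤ 1 := by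
  have h1 : ∫ y, χ.normed volume (x - y) = 1 := by
    rw [integral_sub_left_eq_self (χ.normed volume), χ.integral_normed]
  refine le_trans ?_ h1.le
  refine integral_mono_of_nonneg (.of_forall fun y => ?_)
    (χ.integrable_normed.comp_sub_left x) (.of_forall fun y => ?_)
  · exact mul_nonneg (χ.nonneg_normed _) (indicator_nonneg (fun _ _ => zero_le_one) _)
  · exact mul_le_of_le_one_right (χ.nonneg_normed _) (indicator_le_self' (fun _ _ => zero_le_one) _)

/-- Mollification is self-adjoint: Fubini, and the kernel is even. This moves it from the equation
onto the test function. -/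
theorem integral_inner_mollify {H : Type*} [NormedAddCommGroup H] [InnerProductSpace ℝ H]
    [CompleteSpace H] {G h : EuclideanSpace ℝ (Fin d) → H} (hG : Integrable G)
    (hh : Integrable h) :
    ∫ x, inner ℝ (mollify χ G x) (h x) = ∫ y, inner ℝ (G y) (mollify χ h y) := by
  obtain ⟨M, hM0, hM⟩ := χ.exists_normed_le
  have hi : Integrable (Function.uncurry fun x y : EuclideanSpace ℝ (Fin d) =>
      χ.normed volume (x - y) * inner ℝ (G y) (h x)) (volume.prod volume) := by
    refine Integrable.mono' ((hh.norm.mul_prod hG.norm).const_mul M) ?_ (.of_forall ?_)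
    · exact ((χ.continuous_normed.comp (continuous_fst.sub continuous_snd)).aestronglyMeasurable).mul
        ((hG.aestronglyMeasurable.comp_snd).inner (𝕜 := ℝ) (hh.aestronglyMeasurable.comp_fst))
    · rintro ⟨x, y⟩
      simp only [Function.uncurry_apply_pair, norm_mul, Real.norm_of_nonneg (χ.nonneg_normed _)]
      refine mul_le_mul (hM _) ?_ (norm_nonneg _) hM0
      rw [mul_comm]
      exact norm_inner_le_norm _ _
  calc ∫ x, inner ℝ (mollify χ G x) (h x)
      = ∫ x, ∫ y, χ.normed volume (x - y) * inner ℝ (G y) (h x) := by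
        refine integral_congr_ae (.of_forall fun x => ?_)
        simp only
        rw [real_inner_comm, mollify, ← integral_inner (integrable_normed_smul hG x)]
        refine integral_congr_ae (.of_forall fun y => ?_)
        simp only
        rw [real_inner_smul_right, real_inner_comm]
    _ = ∫ y, ∫ x, χ.normed volume (x - y) * inner ℝ (G y) (h x) := integral_integral_swap hi
    _ = ∫ y, inner ℝ (G y) (mollify χ h y) := by
        refine integral_congr_ae (.of_forall fun y => ?_)
        simp only
        rw [mollify, ← integral_inner (integrable_normed_smul hh y)]
        refine integral_congr_ae (.of_forall fun x => ?_)
        simp only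
        rw [real_inner_smul_right, ← neg_sub y x, χ.normed_neg]

theorem gradient_mollify_of_contDiff {φ : EuclideanSpace ℝ (Fin d) → ℝ} (hφ : ContDiff ℝ ∞ φ)
    (hφc : HasCompactSupport φ) (x : EuclideanSpace ℝ (Fin d)) :
    gradient (mollify χ φ) x = mollify χ (gradient φ) x := by
  have h := hφc.hasFDerivAt_convolution_right (ContinuousLinearMap.lsmul ℝ ℝ)
    (χ.integrable_normed (μ := volume)).locallyIntegrable (hφ.of_le (by simp)) x
  have hgc : HasCompactSupport (gradient φ) :=
    HasCompactSupport.intro hφc fun x hx => gradient_eq_zero_of_notMem_tsupport hx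
  have hgi : Integrable (gradient φ) := hφ.continuous_gradient.integrable_of_hasCompactSupport hgc
  have hDi : Integrable (fderiv ℝ φ) :=
    (hφ.continuous_fderiv (by simp)).integrable_of_hasCompactSupport (hφc.fderiv ℝ)
  refine HasGradientAt.gradient ?_
  rw [hasGradientAt_iff_hasFDerivAt, mollify_eq_convolution]
  refine h.congr_fderiv ?_
  rw [convolution_eq_swap]
  ext v
  rw [InnerProductSpace.toDual_apply_apply, real_inner_comm, mollify,
    ← integral_inner (integrable_normed_smul hgi x)]
  rw [ContinuousLinearMap.integral_apply]
  · refine integral_congr_ae (.of_forall fun y => ?_)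
    simp [real_inner_smul_right]
  · exact integrable_normed_smul hDi x

theorem gradient_mollify_eq_integral {f : EuclideanSpace ℝ (Fin d) → ℝ} (hf : Integrable f)
    (x : EuclideanSpace ℝ (Fin d)) :
    gradient (mollify χ f) x = ∫ y, f y • gradient (χ.normed volume) (x - y) := by
  have hχ : ContDiff ℝ ∞ (χ.normed volume) := χ.contDiff_normed
  have hχc : HasCompactSupport (χ.normed volume) := χ.hasCompactSupport_normed
  have h := hχc.hasFDerivAt_convolution_left (ContinuousLinearMap.lsmul ℝ ℝ)
    (hχ.of_le (by simp)) hf.locallyIntegrable x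
  have hb : ∃ M, ∀ z, ‖fderiv ℝ (χ.normed volume) z‖ ≤ M :=
    (hχ.continuous_fderiv (by simp)).bounded_above_of_compact_support (hχc.fderiv ℝ)
  obtain ⟨M, hM⟩ := hb
  have hg : Integrable fun y => f y • gradient (χ.normed volume) (x - y) := by
    refine hf.smul_bdd M ((hχ.continuous_gradient.comp
      (continuous_const.sub continuous_id)).aestronglyMeasurable) (.of_forall fun y => ?_)
    exact (norm_gradient_eq _ _).trans_le (hM _)
  have hD : Integrable fun y => f y • fderiv ℝ (χ.normed volume) (x - y) := by
    exact hf.smul_bdd M (((hχ.continuous_fderiv (by simp)).comp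
      (continuous_const.sub continuous_id)).aestronglyMeasurable) (.of_forall fun y => hM _)
  refine HasGradientAt.gradient ?_
  rw [hasGradientAt_iff_hasFDerivAt, mollify_eq_convolution]
  refine h.congr_fderiv ?_
  rw [convolution_eq_swap]
  ext v
  rw [InnerProductSpace.toDual_apply_apply, real_inner_comm, ← integral_inner hg]
  rw [ContinuousLinearMap.integral_apply]
  · refine integral_congr_ae (.of_forall fun y => ?_)
    simp [real_inner_smul_right, mul_comm]
  · refine hD.congr (.of_forall fun y => ?_)
    ext v
    simp [mul_comm]

theorem ae_tendsto_mollify [CompleteSpace F] {χ : ℕ → ContDiffBump (0 : EuclideanSpace ℝ (Fin d))}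
    (h0 : Tendsto (fun n => (χ n).rOut) atTop (𝓝 0)) (h2 : ∀ n, (χ n).rOut ≤ 2 * (χ n).rIn)
    {f : EuclideanSpace ℝ (Fin d) → F} (hf : Integrable f) :
    ∀ᵐ x, Tendsto (fun n => mollify (χ n) f x) atTop (𝓝 (f x)) := by
  filter_upwards [ContDiffBump.ae_convolution_tendsto_right_of_locallyIntegrable h0
    (.of_forall h2) hf.locallyIntegrable] with x hx
  simpa only [mollify_eq_convolution] using hx

theorem tsupport_mollify_subset {φ : EuclideanSpace ℝ (Fin d) → ℝ}
    {U K : Set (EuclideanSpace ℝ (Fin d))} (hK : IsClosed K) (hφ : tsupport φ ⊆ U)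
    (hUK : ∀ x ∈ U, Metric.closedBall x χ.rOut ⊆ K) : tsupport (mollify χ φ) ⊆ K := by
  refine closure_minimal (fun x hx => ?_) hK
  by_contra hxK
  refine hx (integral_eq_zero_of_ae (.of_forall fun y => ?_))
  by_cases hy : y ∈ U
  · have : χ.rOut ≤ ‖x - y‖ := by
      by_contra! hlt
      exact hxK (hUK y hy (by rw [Metric.mem_closedBall, dist_eq_norm]; exact hlt.le))
    simp [χ.normed_eq_zero this]
  · simp [image_eq_zero_of_notMem_tsupport fun h => hy (hφ h)]

end Mollify

/-! ### Mollifying the weak equation -/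

section MollifyEquation

variable {d : ℕ} {χ : ContDiffBump (0 : EuclideanSpace ℝ (Fin d))}
  {Ω K U : Set (EuclideanSpace ℝ (Fin d))}

theorem setIntegral_inner_eq_integral_indicator {H : Type*} [NormedAddCommGroup H]
    [InnerProductSpace ℝ H] (hΩ : MeasurableSet Ω) (hKΩ : K ⊆ Ω)
    {G h : EuclideanSpace ℝ (Fin d) → H} (hh : ∀ x ∉ K, h x = 0) :
    ∫ x in Ω, inner ℝ (G x) (h x) = ∫ x, inner ℝ (K.indicator G x) (h x) := by
  rw [← integral_indicator hΩ]
  refine integral_congr_ae (.of_forall fun x => ?_)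
  by_cases hx : x ∈ K
  · simp [hx, hKΩ hx]
  · by_cases hxΩ : x ∈ Ω <;> simp [hx, hxΩ, hh x hx]

theorem integrable_indicator_of_locallyIntegrableOn {H : Type*} [NormedAddCommGroup H]
    (hK : IsCompact K) (hKΩ : K ⊆ Ω) {f : EuclideanSpace ℝ (Fin d) → H}
    (hf : LocallyIntegrableOn f Ω) : Integrable (K.indicator f) :=
  (integrable_indicator_iff hK.measurableSet).2 (hf.integrableOn_compact_subset hKΩ hK)

/-- When the kernel centred at x is supported in K, y ↦ χ(x - y) is a test function for the weak
gradient, and the truncation to K is invisible. -/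
theorem gradient_mollify_indicator (hΩ : IsOpen Ω) (hK : IsCompact K) (hKΩ : K ⊆ Ω)
    {ρ : EuclideanSpace ℝ (Fin d) → ℝ}
    {Dρ : EuclideanSpace ℝ (Fin d) → EuclideanSpace ℝ (Fin d)} (h : HasWeakGradient Ω ρ Dρ)
    {x : EuclideanSpace ℝ (Fin d)} (hx : Metric.closedBall x χ.rOut ⊆ K) :
    gradient (mollify χ (K.indicator ρ)) x = mollify χ (K.indicator Dρ) x := by
  set φ : EuclideanSpace ℝ (Fin d) → ℝ := fun y => χ.normed volume (x - y) with hφ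
  have hφs : ContDiff ℝ ∞ φ :=
    (χ.contDiff_normed (n := ⊤)).comp (contDiff_const.sub contDiff_id)
  have hsupp : tsupport φ ⊆ Metric.closedBall x χ.rOut := by
    refine closure_minimal (fun y hy => ?_) Metric.isClosed_closedBall
    by_contra hyn
    rw [Metric.mem_closedBall, not_le, dist_comm, dist_eq_norm] at hyn
    exact hy (χ.normed_eq_zero hyn.le)
  have hφt : IsTestFn Ω φ :=
    ⟨hφs, hK.of_isClosed_subset (isClosed_tsupport _) (hsupp.trans hx), (hsupp.trans hx).trans hKΩ⟩
  have hgrad : ∀ y, gradient φ y = -gradient (χ.normed volume) (x - y) := by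
    intro y
    refine HasGradientAt.gradient ?_
    have h1 := ((χ.contDiff_normed (μ := volume) (n := ⊤)).differentiable (by simp)
      (x - y)).hasFDerivAt.comp y ((hasFDerivAt_id y).const_sub x)
    rw [hasGradientAt_iff_hasFDerivAt, map_neg, toDual_gradient]
    refine h1.congr_fderiv ?_
    ext v
    simp
  have hint := h.integral_eq φ hφt
  rw [gradient_mollify_eq_integral (integrable_indicator_of_locallyIntegrableOn hK hKΩ
    h.locInt_fun)]
  have e1 : ∫ y in Ω, ρ y • gradient φ y =
      -∫ y, K.indicator ρ y • gradient (χ.normed volume) (x - y) := by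
    rw [← integral_neg, ← integral_indicator hΩ.measurableSet]
    refine integral_congr_ae (.of_forall fun y => ?_)
    by_cases hy : y ∈ K
    · simp [hy, hKΩ hy, hgrad]
    · have : gradient φ y = 0 :=
        gradient_eq_zero_of_notMem_tsupport fun h' => hy (hx (hsupp h'))
      by_cases hyΩ : y ∈ Ω <;> simp [hy, hyΩ, this]
  have e2 : ∫ y in Ω, φ y • Dρ y = mollify χ (K.indicator Dρ) x := by
    rw [mollify, ← integral_indicator hΩ.measurableSet]
    refine integral_congr_ae (.of_forall fun y => ?_)
    by_cases hy : y ∈ K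
    · simp [hy, hKΩ hy, hφ]
    · have : φ y = 0 := image_eq_zero_of_notMem_tsupport fun h' => hy (hx (hsupp h'))
      by_cases hyΩ : y ∈ Ω <;> simp [hy, hyΩ, this]
  rw [e1, e2, neg_inj] at hint
  exact hint

/-- Mollification of a nonnegative weak solution gives a subsolution of the mollified equation. -/
theorem IsWeakSol.mollify_le (hΩ : IsOpen Ω) (hK : IsCompact K) (hKΩ : K ⊆ Ω)
    (hUK : ∀ x ∈ U, Metric.closedBall x χ.rOut ⊆ K) {lam : ℝ} (hlam : 0 ≤ lam)
    {b Dρ : EuclideanSpace ℝ (Fin d) → EuclideanSpace ℝ (Fin d)}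
    {ψ ρ φ : EuclideanSpace ℝ (Fin d) → ℝ} (hsol : IsWeakSol Ω lam b ψ ρ Dρ)
    (hDρ : LocallyIntegrableOn Dρ Ω) (hρ : ∀ᵐ x, 0 ≤ K.indicator ρ x)
    (hφ : IsTestFn U φ) (hφ0 : ∀ x, 0 ≤ φ x) :
    ∫ x, inner ℝ (mollify χ (K.indicator Dρ) x) (gradient φ x) ≤
      (∫ x, inner ℝ (mollify χ (K.indicator fun x => ρ x • b x) x) (gradient φ x))
        + ∫ x, mollify χ (K.indicator ψ) x * φ x := by
  set Φ := mollify χ φ with hΦ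
  have hφi : Integrable φ := hφ.smooth.continuous.integrable_of_hasCompactSupport hφ.compact
  have hgi : Integrable (gradient φ) :=
    hφ.smooth.continuous_gradient.integrable_of_hasCompactSupport
      (HasCompactSupport.intro hφ.compact fun x hx => gradient_eq_zero_of_notMem_tsupport hx)
  have hΦsupp : tsupport Φ ⊆ K := tsupport_mollify_subset hK.isClosed hφ.support_subset hUK
  have hΦt : IsTestFn Ω Φ := ⟨contDiff_mollify hφi.locallyIntegrable,
    hK.of_isClosed_subset (isClosed_tsupport _) hΦsupp, hΦsupp.trans hKΩ⟩
  have hΦ0 : ∀ x ∉ K, Φ x = 0 := fun x hx =>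
    image_eq_zero_of_notMem_tsupport fun h => hx (hΦsupp h)
  have hgΦ0 : ∀ x ∉ K, gradient Φ x = 0 := fun x hx =>
    gradient_eq_zero_of_notMem_tsupport fun h => hx (hΦsupp h)
  have hgΦ : gradient Φ = mollify χ (gradient φ) :=
    funext fun x => gradient_mollify_of_contDiff hφ.smooth hφ.compact x
  have hw := hsol.weak_form Φ hΦt
  have t1 := integral_inner_mollify (χ := χ)
    (integrable_indicator_of_locallyIntegrableOn hK hKΩ hDρ) hgi
  have t2 := integral_inner_mollify (χ := χ)
    (integrable_indicator_of_locallyIntegrableOn hK hKΩ hsol.locInt_flux) hgi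
  have t3 := integral_inner_mollify (χ := χ)
    (integrable_indicator_of_locallyIntegrableOn hK hKΩ hsol.locInt_source) hφi
  -- The zeroth-order term has a sign, since both ρ on K and the mollified test function are
  -- nonnegative. Dropping it makes the bound independent of λ.
  have t4 : 0 ≤ ∫ x in Ω, ρ x * Φ x := by
    have : ∫ x in Ω, inner ℝ (ρ x) (Φ x) = _ :=
      setIntegral_inner_eq_integral_indicator hΩ.measurableSet hKΩ hΦ0
    simp only [RCLike.inner_apply, conj_trivial] at this
    simp only [mul_comm (Φ _)] at this
    rw [this]
    refine integral_nonneg_of_ae (hρ.mono fun x hx => mul_nonneg hx ?_)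
    exact mollify_nonneg (.of_forall hφ0) x
  rw [← hgΦ, ← setIntegral_inner_eq_integral_indicator hΩ.measurableSet hKΩ hgΦ0] at t1 t2
  rw [← hΦ, ← setIntegral_inner_eq_integral_indicator hΩ.measurableSet hKΩ hΦ0] at t3
  simp only [RCLike.inner_apply, conj_trivial, mul_comm (φ _), mul_comm (Φ _)] at t3
  rw [t1, t2, t3]
  have := mul_nonneg hlam t4
  linarith

end MollifyEquation

/-! ### The local estimate for normalized data -/

section LocalEstimate

open Filter Topology

theorem setIntegral_mollify_indicator_le {d : ℕ}
    {χ : ContDiffBump (0 : EuclideanSpace ℝ (Fin d))} {K U : Set (EuclideanSpace ℝ (Fin d))}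
    (hK : MeasurableSet K) {f : EuclideanSpace ℝ (Fin d) → ℝ} (hf : Integrable (K.indicator f))
    (hf0 : ∀ᵐ x, 0 ≤ K.indicator f x) :
    ∫ x in U, mollify χ (K.indicator f) x ≤ ∫ x in K, f x := by
  rw [← integral_indicator hK, ← integral_mollify (χ := χ) hf]
  exact setIntegral_le_integral (integrable_mollify hf) (.of_forall (mollify_nonneg hf0))

/-- The estimate on a fixed mollification scale. -/
theorem exists_mollify_bound {d : ℕ} {s r θ q N τ k p' : ℝ} {m : ℕ}
    (hex : EnergyExponents d s r θ q N m) (hτ0 : 0 < τ) (hτ2 : τ < 2)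
    (hτ : (2 - s) * (τ / 2) = r * (1 - τ / 2)) (hk : k * (1 - θ) = 2) (hp' : p' * (1 - q) = 1)
    {R : ℝ} (hR : 0 < R) :
    ∃ C : ℝ, 0 ≤ C ∧ ∀ (Ω : Set (EuclideanSpace ℝ (Fin d))), IsOpen Ω →
      Metric.closedBall 0 (7 * R / 8) ⊆ Ω → ∀ (lam : ℝ), 0 ≤ lam →
      ∀ (b : EuclideanSpace ℝ (Fin d) → EuclideanSpace ℝ (Fin d))
        (ψ ρ : EuclideanSpace ℝ (Fin d) → ℝ)
        (Dρ : EuclideanSpace ℝ (Fin d) → EuclideanSpace ℝ (Fin d)),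
        HasWeakGradient Ω ρ Dρ → IsWeakSol Ω lam b ψ ρ Dρ →
        (∀ᵐ x, 0 ≤ (Metric.closedBall 0 (7 * R / 8)).indicator ρ x) →
        IntegrableOn (fun x => ρ x * ‖b x‖ ^ k) (Metric.closedBall 0 (7 * R / 8)) →
        IntegrableOn (fun x => |ψ x| ^ p') (Metric.closedBall 0 (7 * R / 8)) →
        ∫ x in Metric.closedBall 0 (7 * R / 8), ρ x * ‖b x‖ ^ k ≤ 1 →
        ∫ x in Metric.closedBall 0 (7 * R / 8), |ψ x| ^ p' ≤ 1 →
        ∫ x in Metric.closedBall 0 (7 * R / 8), ρ x ≤ 1 →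
        ∀ (χ : ContDiffBump (0 : EuclideanSpace ℝ (Fin d))), χ.rOut ≤ R / 8 →
        ∀ ε : ℝ, 0 < ε → ε ≤ 1 →
        eLpNorm (fun x => mollify χ ((Metric.closedBall 0 (7 * R / 8)).indicator ρ) x + ε)
            (ENNReal.ofReal r) (volume.restrict (Metric.ball 0 (R / 2)))
          ≤ ENNReal.ofReal (C ^ (1 / r)) ∧
        eLpNorm (mollify χ ((Metric.closedBall 0 (7 * R / 8)).indicator Dρ))
            (ENNReal.ofReal τ) (volume.restrict (Metric.ball 0 (R / 2)))
          ≤ ENNReal.ofReal (C ^ (1 / τ)) := by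
  set K : Set (EuclideanSpace ℝ (Fin d)) := Metric.closedBall 0 (7 * R / 8) with hKdef
  set U : Set (EuclideanSpace ℝ (Fin d)) := Metric.closedBall 0 (3 * R / 4) with hUdef
  have hK : IsCompact K := isCompact_closedBall _ _
  have hU : IsCompact U := isCompact_closedBall _ _
  have hd' : (2 : ℝ) < d := by exact_mod_cast hex.two_lt
  have hq0 := hex.q_pos
  have hθ0 : 0 < θ := hq0.trans_le hex.q_le
  have hθ1 : θ < 1 := hex.θ_lt.trans (by rw [div_lt_one (by linarith)]; linarith)
  have hq1 : 0 < 1 - q := by linarith [hex.q_le]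
  have ht0 : 0 < 2 * d / ((d : ℝ) - 2) := div_pos (by linarith) (by linarith)
  have hr : 0 < r := by rw [← hex.r_eq]; have := hex.one_lt_s; positivity
  have hN : 0 ≤ N := by rw [← hex.N_eq]; positivity
  -- The radii nest as R/2 < 3R/4 < 7R/8: η is 1 on the ball of the conclusion and supported in U,
  -- and mollifying at scale at most R/8 on U sees only K.
  set η : ContDiffBump (0 : EuclideanSpace ℝ (Fin d)) :=
    ⟨R / 2, 3 * R / 4, by linarith, by linarith⟩ with hη
  -- Mass of u + ε on U: at most 1 from ρ and at most the volume of U from ε ≤ 1.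
  set κ : ℝ := 1 + volume.real U with hκ
  obtain ⟨C, hC0, hC⟩ := exists_energy_bound hex hU η.contDiff (fun _ => η.nonneg)
    (fun _ => η.le_one) η.tsupport_eq.subset (κ := κ) (by positivity)
  refine ⟨C, hC0, ?_⟩
  intro Ω hΩ hKΩ lam hlam b ψ ρ Dρ hgrad hsol hρ0 hBi hGi hB hG hρ1 χ hχ ε hε hε1
  have hUK : ∀ x ∈ U, Metric.closedBall x χ.rOut ⊆ K := by
    intro x hx
    refine Metric.closedBall_subset_closedBall' ?_
    have := Metric.mem_closedBall.1 hx
    linarith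
  have hBU : Metric.ball 0 (R / 2) ⊆ U :=
    Metric.ball_subset_closedBall.trans (Metric.closedBall_subset_closedBall (by linarith))
  have iρ := integrable_indicator_of_locallyIntegrableOn hK hKΩ hgrad.locInt_fun
  have iψ := integrable_indicator_of_locallyIntegrableOn hK hKΩ hsol.locInt_source
  have iF := integrable_indicator_of_locallyIntegrableOn hK hKΩ hsol.locInt_flux
  have iB : Integrable (K.indicator fun x => ρ x * ‖b x‖ ^ k) :=
    (integrable_indicator_iff hK.measurableSet).2 hBi
  have iG : Integrable (K.indicator fun x => |ψ x| ^ p') :=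
    (integrable_indicator_iff hK.measurableSet).2 hGi
  have i1 : Integrable (K.indicator fun _ => (1 : ℝ)) :=
    (integrable_indicator_iff hK.measurableSet).2 (integrableOn_const hK.measure_lt_top.ne)
  have hB0 : ∀ᵐ x, 0 ≤ K.indicator (fun x => ρ x * ‖b x‖ ^ k) x := by
    filter_upwards [hρ0] with x hx
    by_cases hxK : x ∈ K
    · simp only [hxK, indicator_of_mem] at hx ⊢
      positivity
    · simp [hxK]
  have hG0 : ∀ x, 0 ≤ K.indicator (fun x => |ψ x| ^ p') x := fun x =>
    indicator_nonneg (fun x _ => by positivity) x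
  have h10 : ∀ x, 0 ≤ K.indicator (fun _ => (1 : ℝ)) x := fun x =>
    indicator_nonneg (fun x _ => zero_le_one) x
  set u := mollify χ (K.indicator ρ) with hu
  have hus : ContDiff ℝ ∞ u := contDiff_mollify iρ.locallyIntegrable
  have hu0 : ∀ x, 0 ≤ u x := mollify_nonneg hρ0
  have hws : ContDiff ℝ ∞ fun x => u x + ε := hus.add contDiff_const
  have hw0 : ∀ x, 0 < u x + ε := fun x => by linarith [hu0 x]
  have hgw : ∀ x, gradient (fun x => u x + ε) x = gradient u x := fun x => by
    simp [gradient, fderiv_add_const]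
  have hgu : ∀ x ∈ U, gradient u x = mollify χ (K.indicator Dρ) x := fun x hx =>
    gradient_mollify_indicator hΩ hK hKΩ hgrad (hUK x hx)
  -- Since (1-θ)/2 = 1/k, the flux factors as ρ|b| = (ρ|b|^k)^((1-θ)/2) ρ^((1+θ)/2), with exponents
  -- summing to 1, so Jensen applies.
  have hFbound : ∀ x, ‖mollify χ (K.indicator fun x => ρ x • b x) x‖ ≤
      mollify χ (K.indicator fun x => ρ x * ‖b x‖ ^ k) x ^ ((1 - θ) / 2)
        * u x ^ ((1 + θ) / 2) := by
    refine norm_mollify_le iB iρ hB0 hρ0 (by linarith) (by linarith) (by ring) ?_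
    filter_upwards [hρ0] with x hx
    by_cases hxK : x ∈ K
    · simp only [hxK, indicator_of_mem] at hx ⊢
      rw [norm_smul, Real.norm_of_nonneg hx, Real.mul_rpow hx (by positivity),
        ← Real.rpow_mul (norm_nonneg _), show k * ((1 - θ) / 2) = 1 by linarith, Real.rpow_one,
        mul_right_comm, ← Real.rpow_add' hx (by ring_nf; norm_num),
        show (1 - θ) / 2 + (1 + θ) / 2 = 1 by ring, Real.rpow_one]
    · simp only [hxK, not_false_eq_true, indicator_of_notMem, norm_zero]
      positivity
  have hGbound : ∀ x, |mollify χ (K.indicator ψ) x| ≤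
      mollify χ (K.indicator fun x => |ψ x| ^ p') x ^ (1 - q) := by
    intro x
    have := norm_mollify_le (χ := χ) (f := K.indicator ψ) iG i1 (.of_forall hG0) (.of_forall h10)
      hq1 hq0 (by ring)
      (.of_forall fun x => by
        by_cases hxK : x ∈ K
        · simp only [hxK, indicator_of_mem]
          rw [← Real.rpow_mul (abs_nonneg _), hp', Real.rpow_one, Real.one_rpow, mul_one,
            Real.norm_eq_abs]
        · simp only [hxK, not_false_eq_true, indicator_of_notMem, norm_zero]
          positivity) x
    refine this.trans (mul_le_of_le_one_right
      (Real.rpow_nonneg (mollify_nonneg (.of_forall hG0) x) _) ?_)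
    exact Real.rpow_le_one (mollify_nonneg (.of_forall h10) x) (mollify_indicator_one_le x) hq0.le
  obtain ⟨hI, hE⟩ := hC (fun x => u x + ε) (mollify χ (K.indicator ψ))
    (mollify χ (K.indicator fun x => ρ x * ‖b x‖ ^ k))
    (mollify χ (K.indicator fun x => |ψ x| ^ p'))
    (mollify χ (K.indicator fun x => ρ x • b x)) hws hw0
    (contDiff_mollify iF.locallyIntegrable).continuous
    (contDiff_mollify iψ.locallyIntegrable).continuous
    (mollify_nonneg hB0) (mollify_nonneg (.of_forall hG0))
    (integrable_mollify iB).integrableOn (integrable_mollify iG).integrableOn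
    ((setIntegral_mollify_indicator_le hK.measurableSet iB hB0).trans hB)
    ((setIntegral_mollify_indicator_le hK.measurableSet iG (.of_forall hG0)).trans hG)
    (by
      rw [integral_add (integrable_mollify iρ).integrableOn
        (integrableOn_const hU.measure_lt_top.ne), setIntegral_const, smul_eq_mul]
      refine add_le_add ((setIntegral_mollify_indicator_le hK.measurableSet iρ hρ0).trans hρ1) ?_
      exact mul_le_of_le_one_right measureReal_nonneg hε1)
    (fun x _ => by
      have hBx := mollify_nonneg (χ := χ) hB0 x
      have h2 := pow_le_pow_left₀ (norm_nonneg _) (hFbound x) 2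
      rw [mul_pow, ← Real.rpow_mul_natCast hBx, ← Real.rpow_mul_natCast (hu0 x)] at h2
      norm_num at h2
      refine h2.trans (mul_le_mul_of_nonneg_left ?_ (Real.rpow_nonneg hBx _))
      exact Real.rpow_le_rpow (hu0 x) (by linarith) (by linarith))
    (fun x _ => hGbound x)
    (fun φ hφ hφ0 => by
      refine le_trans (le_of_eq ?_) (hsol.mollify_le hΩ hK hKΩ hUK hlam hgrad.locInt_grad hρ0
        hφ hφ0)
      refine integral_congr_ae (.of_forall fun x => ?_)
      simp only
      by_cases hx : x ∈ U
      · rw [hgw, hgu x hx]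
      · rw [gradient_eq_zero_of_notMem_tsupport fun h => hx (hφ.support_subset h)]
        simp)
  obtain ⟨h1, h2⟩ := eLpNorm_le_of_energy_le hr hτ0 hτ2 hτ hN hU Metric.isOpen_ball.measurableSet
    hBU η.continuous (fun _ => η.nonneg)
    (fun x hx => η.one_of_mem_closedBall (Metric.ball_subset_closedBall hx)) hws hw0 hC0 hI hE
  refine ⟨h1, (le_of_eq (eLpNorm_congr_ae ?_)).trans h2⟩
  refine (ae_restrict_iff' Metric.isOpen_ball.measurableSet).2 (.of_forall fun x hx => ?_)
  rw [hgw, hgu x (hBU hx)]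

/-- The local estimate for data normalized to have size at most one. -/
theorem exists_normalized_bound {d : ℕ} {s r θ q N τ k p' : ℝ} {m : ℕ}
    (hex : EnergyExponents d s r θ q N m) (hτ0 : 0 < τ) (hτ2 : τ < 2)
    (hτ : (2 - s) * (τ / 2) = r * (1 - τ / 2)) (hk : k * (1 - θ) = 2) (hp' : p' * (1 - q) = 1)
    {R : ℝ} (hR : 0 < R) :
    ∃ C : ℝ, 0 ≤ C ∧ ∀ (Ω : Set (EuclideanSpace ℝ (Fin d))), IsOpen Ω →
      Metric.closedBall 0 (7 * R / 8) ⊆ Ω → ∀ (lam : ℝ), 0 ≤ lam →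
      ∀ (b : EuclideanSpace ℝ (Fin d) → EuclideanSpace ℝ (Fin d))
        (ψ ρ : EuclideanSpace ℝ (Fin d) → ℝ)
        (Dρ : EuclideanSpace ℝ (Fin d) → EuclideanSpace ℝ (Fin d)),
        HasWeakGradient Ω ρ Dρ → IsWeakSol Ω lam b ψ ρ Dρ →
        (∀ᵐ x, 0 ≤ (Metric.closedBall 0 (7 * R / 8)).indicator ρ x) →
        IntegrableOn (fun x => ρ x * ‖b x‖ ^ k) (Metric.closedBall 0 (7 * R / 8)) →
        IntegrableOn (fun x => |ψ x| ^ p') (Metric.closedBall 0 (7 * R / 8)) →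
        ∫ x in Metric.closedBall 0 (7 * R / 8), ρ x * ‖b x‖ ^ k ≤ 1 →
        ∫ x in Metric.closedBall 0 (7 * R / 8), |ψ x| ^ p' ≤ 1 →
        ∫ x in Metric.closedBall 0 (7 * R / 8), ρ x ≤ 1 →
        eLpNorm ρ (ENNReal.ofReal r) (volume.restrict (Metric.ball 0 (R / 2)))
            + eLpNorm Dρ (ENNReal.ofReal τ) (volume.restrict (Metric.ball 0 (R / 2)))
          ≤ ENNReal.ofReal C := by
  obtain ⟨C, hC0, hC⟩ := exists_mollify_bound hex hτ0 hτ2 hτ hk hp' hR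
  refine ⟨C ^ (1 / r) + C ^ (1 / τ), by positivity, ?_⟩
  intro Ω hΩ hKΩ lam hlam b ψ ρ Dρ hgrad hsol hρ0 hBi hGi hB hG hρ1
  rw [ENNReal.ofReal_add (by positivity) (by positivity)]
  set K : Set (EuclideanSpace ℝ (Fin d)) := Metric.closedBall 0 (7 * R / 8) with hKdef
  have hK : IsCompact K := isCompact_closedBall _ _
  have hVK : Metric.ball 0 (R / 2) ⊆ K :=
    Metric.ball_subset_closedBall.trans (Metric.closedBall_subset_closedBall (by linarith))
  have iρ := integrable_indicator_of_locallyIntegrableOn hK hKΩ hgrad.locInt_fun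
  have iD := integrable_indicator_of_locallyIntegrableOn hK hKΩ hgrad.locInt_grad
  have hδ : ∀ n : ℕ, 0 < R / 8 * (1 / ((n : ℝ) + 1)) := fun n => by positivity
  -- The ratio of outer to inner radius stays equal to 2, as the almost everywhere convergence of
  -- the mollifications requires.
  set χ : ℕ → ContDiffBump (0 : EuclideanSpace ℝ (Fin d)) := fun n =>
    ⟨R / 8 * (1 / ((n : ℝ) + 1)) / 2, R / 8 * (1 / ((n : ℝ) + 1)), half_pos (hδ n),
      half_lt_self (hδ n)⟩ with hχ
  have hlim := tendsto_one_div_add_atTop_nhds_zero_nat (𝕜 := ℝ)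
  have hone : ∀ n : ℕ, 1 / ((n : ℝ) + 1) ≤ 1 := fun n =>
    (div_le_one (by positivity)).2 (by linarith [(Nat.cast_nonneg n : (0 : ℝ) ≤ n)])
  have h0 : Tendsto (fun n => (χ n).rOut) atTop (𝓝 0) := by
    have := hlim.const_mul (R / 8)
    rwa [mul_zero] at this
  have h2 : ∀ n, (χ n).rOut ≤ 2 * (χ n).rIn := fun n => by
    simp only [hχ]; linarith
  have hbound := fun n : ℕ => hC Ω hΩ hKΩ lam hlam b ψ ρ Dρ hgrad hsol hρ0 hBi hGi hB hG hρ1 (χ n)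
    (mul_le_of_le_one_right (by positivity) (hone n)) (1 / ((n : ℝ) + 1)) (by positivity) (hone n)
  have hVm : MeasurableSet (Metric.ball (0 : EuclideanSpace ℝ (Fin d)) (R / 2)) :=
    Metric.isOpen_ball.measurableSet
  -- Fatou carries the uniform bounds to the limit; truncation to K does not change the limit on the
  -- smaller ball.
  have fatou : ∀ {H : Type} [NormedAddCommGroup H] {f : ℕ → EuclideanSpace ℝ (Fin d) → H}
      {g : EuclideanSpace ℝ (Fin d) → H} {p B : ℝ≥0∞}, (∀ n, Continuous (f n)) →
      [SecondCountableTopologyEither (EuclideanSpace ℝ (Fin d)) H] →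
      (∀ᵐ x, Tendsto (fun n => f n x) atTop (𝓝 (K.indicator g x))) →
      (∀ n, eLpNorm (f n) p (volume.restrict (Metric.ball 0 (R / 2))) ≤ B) →
      eLpNorm g p (volume.restrict (Metric.ball 0 (R / 2))) ≤ B := by
    intro H _ f g p B hf _ hfg hB
    refine (Lp.eLpNorm_lim_le_liminf_eLpNorm (f := f)
      (fun n => (hf n).aestronglyMeasurable) g ?_).trans ?_
    · rw [ae_restrict_iff' hVm]
      filter_upwards [hfg] with x hx hxV
      rwa [indicator_of_mem (hVK hxV)] at hx
    · exact (liminf_le_liminf (.of_forall hB)).trans (liminf_const B).le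
  refine add_le_add (fatou (fun n => ?_) ?_ fun n => (hbound n).1)
    (fatou (fun n => ?_) ?_ fun n => (hbound n).2)
  · exact (contDiff_mollify iρ.locallyIntegrable).continuous.add continuous_const
  · filter_upwards [ae_tendsto_mollify h0 h2 iρ] with x hx
    simpa using hx.add hlim
  · exact (contDiff_mollify iD.locallyIntegrable).continuous
  · exact ae_tendsto_mollify h0 h2 iD

end LocalEstimate

/-! ### Homogeneity in (ρ, ψ) for fixed drift -/

section Scaling

variable {d : ℕ} {Ω : Set (EuclideanSpace ℝ (Fin d))} {ρ ψ : EuclideanSpace ℝ (Fin d) → ℝ}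
  {b Dρ : EuclideanSpace ℝ (Fin d) → EuclideanSpace ℝ (Fin d)}

theorem locallyIntegrableOn_const_smul {F : Type*} [NormedAddCommGroup F] [NormedSpace ℝ F]
    {f : EuclideanSpace ℝ (Fin d) → F} (hf : LocallyIntegrableOn f Ω) (c : ℝ) :
    LocallyIntegrableOn (fun x => c • f x) Ω := fun x hx =>
  (hf x hx).smul c

theorem HasWeakGradient.const_smul (h : HasWeakGradient Ω ρ Dρ) (c : ℝ) :
    HasWeakGradient Ω (fun x => c * ρ x) (fun x => c • Dρ x) where
  locInt_fun := locallyIntegrableOn_const_smul h.locInt_fun c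
  locInt_grad := locallyIntegrableOn_const_smul h.locInt_grad c
  integral_eq φ hφ := by
    simp_rw [mul_smul, smul_comm (φ _) c, integral_smul, h.integral_eq φ hφ, smul_neg]

theorem IsWeakSol.const_smul {lam : ℝ} (h : IsWeakSol Ω lam b ψ ρ Dρ) (c : ℝ) :
    IsWeakSol Ω lam b (fun x => c * ψ x) (fun x => c * ρ x) (fun x => c • Dρ x) where
  locInt_flux := by
    simp_rw [mul_smul]
    exact locallyIntegrableOn_const_smul h.locInt_flux c
  locInt_source := locallyIntegrableOn_const_smul h.locInt_source c
  weak_form φ hφ := by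
    simp_rw [mul_smul, real_inner_smul_left _ _ c, mul_assoc c, integral_const_mul,
      ← h.weak_form φ hφ]
    ring

end Scaling

/-! ### Choice of exponents and the weighted measure -/

theorem MemLpLoc.mono_exponent {d : ℕ} {F : Type*} [NormedAddCommGroup F]
    {Ω : Set (EuclideanSpace ℝ (Fin d))} {p q : ℝ≥0∞} {f : EuclideanSpace ℝ (Fin d) → F}
    (h : MemLpLoc Ω q volume f) (hpq : p ≤ q) : MemLpLoc Ω p volume f := fun K hK hKΩ => by
  have : IsFiniteMeasure (volume.restrict K) := ⟨by
    rw [Measure.restrict_apply_univ]; exact hK.measure_lt_top⟩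
  exact (h K hK hKΩ).mono_exponent hpq

/-- The inequality s > 1 is k > 2, and both q ≤ θ and θ < (d-2)/d reduce to k < d, which follows
from k < 1 + d/2 and d > 2. -/
theorem exists_energyExponents {d : ℕ} {k : ℝ} (hk_lower : 2 < k) (hk_upper : k < 1 + (d : ℝ) / 2) :
    ∃ (N : ℝ) (m : ℕ), EnergyExponents d (((d : ℝ) - 2) / (d - k)) ((d : ℝ) / (d - k))
      ((k - 2) / k) ((k - 2) / d) N m := by
  have hd : (2 : ℝ) < d := by linarith
  have h1 : 0 < (d : ℝ) - 2 := by linarith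
  have h2 : 0 < (d : ℝ) - k := by linarith
  have hk0 : 0 < k := by linarith
  -- N θ ≤ 2m - 2 amounts to m ≥ (d-2)k / (2(d-k)); the extra 1 ensures m ≥ 1.
  obtain ⟨m, hm⟩ := exists_nat_ge (((d : ℝ) - 2) * k / (2 * (d - k)) + 1)
  have hm0 : 0 ≤ ((d : ℝ) - 2) * k / (2 * (d - k)) := by positivity
  have hm1 : (1 : ℝ) ≤ m := by linarith
  refine ⟨m * (2 * d / ((d : ℝ) - 2)), m, ?_⟩
  constructor
  · exact_mod_cast hd
  · exact_mod_cast hm1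
  · rw [lt_div_iff₀ h2]; linarith
  · exact div_pos (by linarith) (by linarith)
  · exact div_le_div_of_nonneg_left (by linarith) hk0 (by linarith)
  · rw [div_lt_div_iff₀ hk0 (by linarith)]; nlinarith
  · field_simp; ring
  · field_simp; ring
  · field_simp
  · rfl
  · have h3 : ((d : ℝ) - 2) * k ≤ m * (2 * (d - k)) := by
      rw [← div_le_iff₀ (by positivity)]; linarith
    have e : m * (2 * d / ((d : ℝ) - 2)) * ((k - 2) / k)
        = 2 * m * (d * (k - 2)) / (((d : ℝ) - 2) * k) := by field_simp
    rw [e, div_le_iff₀ (by positivity)]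
    linarith
  · have e : m * (2 * d / ((d : ℝ) - 2)) * ((k - 2) / d)
        = 2 * m * ((k - 2) / ((d : ℝ) - 2)) := by field_simp
    rw [e]
    exact mul_le_of_le_one_right (by positivity) ((div_le_one h1).2 (by linarith))

/-- Integrability of `|b|^k ρ` and the value of its integral from the density measure. -/
theorem integrableOn_and_ofReal_setIntegral_le {d : ℕ} {S K : Set (EuclideanSpace ℝ (Fin d))}
    (hK : IsCompact K) (hKS : K ⊆ S) {k : ℝ} (hk : 0 < k)
    {b : EuclideanSpace ℝ (Fin d) → EuclideanSpace ℝ (Fin d)}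
    {ρ : EuclideanSpace ℝ (Fin d) → ℝ} (hρ : ∀ᵐ x ∂(volume.restrict K), 0 ≤ ρ x)
    (hρm : AEMeasurable ρ (volume.restrict K))
    (hb : MemLp b (ENNReal.ofReal k) ((densityMeasure S ρ).restrict K)) :
    IntegrableOn (fun x => ρ x * ‖b x‖ ^ k) K ∧
      ENNReal.ofReal (∫ x in K, ρ x * ‖b x‖ ^ k) ≤
        ∫⁻ x, ‖b x‖ₑ ^ k ∂(densityMeasure S ρ) := by
  have hrestr : (densityMeasure S ρ).restrict K =
      (volume.restrict K).withDensity fun x => ENNReal.ofReal (ρ x) := by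
    rw [densityMeasure, restrict_withDensity hK.measurableSet,
      Measure.restrict_restrict hK.measurableSet, inter_eq_left.2 hKS]
  have hle : ∫⁻ x, ‖b x‖ₑ ^ k ∂((densityMeasure S ρ).restrict K) ≤
      ∫⁻ x, ‖b x‖ₑ ^ k ∂(densityMeasure S ρ) := lintegral_mono' Measure.restrict_le_self le_rfl
  rw [hrestr] at hb hle
  have hm : AEMeasurable (fun x => ENNReal.ofReal (ρ x)) (volume.restrict K) := hρm.ennreal_ofReal
  have hi := hb.integrable_norm_rpow (by simpa using hk) ENNReal.ofReal_ne_top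
  rw [ENNReal.toReal_ofReal hk.le, integrable_withDensity_iff_integrable_smul₀' hm
    (.of_forall fun x => ENNReal.ofReal_lt_top)] at hi
  have hi' : IntegrableOn (fun x => ρ x * ‖b x‖ ^ k) K := by
    refine hi.congr ?_
    filter_upwards [hρ] with x hx
    rw [ENNReal.toReal_ofReal hx, smul_eq_mul]
  refine ⟨hi', le_trans (le_of_eq ?_) hle⟩
  rw [ofReal_integral_eq_lintegral_ofReal hi' (hρ.mono fun x hx => mul_nonneg hx (by positivity)),
    lintegral_withDensity_eq_lintegral_mul₀' hm (hb.aestronglyMeasurable.enorm.pow_const k)]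
  refine lintegral_congr_ae ?_
  filter_upwards [hρ] with x hx
  rw [ENNReal.ofReal_mul hx, Pi.mul_apply, ← ofReal_norm,
    ENNReal.ofReal_rpow_of_nonneg (norm_nonneg _) hk.le]

/-! ### The theorem -/

theorem proposition3p4 (d : ℕ) (σ σ' k p p' R : ℝ)
    (hσ : σ.HolderConjugate σ')
    (hσ'_lower : (d : ℝ) / ((d : ℝ) - 1) < σ') (hσ'_upper : σ' < (d : ℝ))
    (hk : k = 1 + (d : ℝ) / σ) (hk_lower : 2 < k) (hk_upper : k < 1 + (d : ℝ) / 2)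
    (hp : p = (d : ℝ) / (k - 2)) (hp' : p.HolderConjugate p')
    (hR : 0 < R) :
    ∃ C : ℝ≥0 → ℝ≥0,
      ∀ (Ω : Set (EuclideanSpace ℝ (Fin d))), IsOpen Ω → Metric.ball 0 R ⊆ Ω →
      ∀ (lam : ℝ), 0 < lam →
      ∀ (b : EuclideanSpace ℝ (Fin d) → EuclideanSpace ℝ (Fin d))
        (ψ ρ : EuclideanSpace ℝ (Fin d) → ℝ)
        (Dρ : EuclideanSpace ℝ (Fin d) → EuclideanSpace ℝ (Fin d)),
        MemW1Loc Ω 2 ρ Dρ →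
        IsWeakSol Ω lam b ψ ρ Dρ →
        (∀ᵐ x ∂(volume.restrict (Metric.ball 0 R)), 0 ≤ ρ x) →
        MemLp ψ (ENNReal.ofReal p') (volume.restrict (Metric.ball 0 R)) →
        MemLpLoc (Metric.ball 0 R) (ENNReal.ofReal k)
          (densityMeasure (Metric.ball 0 R) ρ) b →
        MemW1Loc Ω (ENNReal.ofReal σ') ρ Dρ ∧
        ∀ M : ℝ≥0, eLpNorm ρ 1 (volume.restrict (Metric.ball 0 R)) ≤ M →
          eLpNorm ρ (ENNReal.ofReal ((d : ℝ) / ((d : ℝ) - k)))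
              (volume.restrict (Metric.ball 0 (R / 2)))
            + eLpNorm Dρ (ENNReal.ofReal σ') (volume.restrict (Metric.ball 0 (R / 2)))
          ≤ C M * ((∫⁻ x, ‖b x‖ₑ ^ k ∂(densityMeasure (Metric.ball 0 R) ρ))
              + eLpNorm ψ (ENNReal.ofReal p') (volume.restrict (Metric.ball 0 R)) + 1) := by
  have hσ1 : 1 < σ := hσ.lt
  have hd : (2 : ℝ) < d := by linarith
  have hk0 : 0 < k := by linarith
  have hdk : 0 < (d : ℝ) - k := by linarith
  have hσk : σ = d / (k - 1) := by
    rw [eq_div_iff (by linarith), hk]; field_simp; ring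
  have hσ' : σ' = d / (d - k + 1) := by
    have h1 : σ - 1 ≠ 0 := by linarith
    have hk1 : k - 1 ≠ 0 := by linarith
    have e : (d : ℝ) / (k - 1) - 1 = (d - k + 1) / (k - 1) := by field_simp; ring
    rw [hσ.conjugate_eq, hσk, e]
    have : (d : ℝ) - k + 1 ≠ 0 := by linarith
    field_simp
  -- With σ' = d/(d-k+1), this is precisely k < 1 + d/2.
  have hσ'2 : σ' < 2 := by
    rw [hσ', div_lt_iff₀ (by linarith)]; linarith
  have hσ'0 : 0 < σ' := hσ.symm.pos
  have hp'0 : 0 < p' := hp'.symm.pos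
  obtain ⟨N, m, hex⟩ := exists_energyExponents hk_lower hk_upper
  obtain ⟨C, hC0, hC⟩ := exists_normalized_bound hex hσ'0 hσ'2
    (k := k) (p' := p') (by
      rw [hσ']
      have : (d : ℝ) - k + 1 ≠ 0 := by linarith
      field_simp
      ring) (by field_simp; ring) (by
      have h1 := hp'.symm.inv_add_inv_eq_one
      have h2 : p⁻¹ = (k - 2) / d := by rw [hp, inv_div]
      rw [← h2, show 1 - p⁻¹ = p'⁻¹ by linarith, mul_inv_cancel₀ hp'0.ne']) hR
  -- The factor 1 + M comes from bounding the normalizing size A + Ψ + M + 1 by (1 + M) times the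
  -- right-hand side.
  refine ⟨fun M => (1 + M) * C.toNNReal, ?_⟩
  intro Ω hΩ hBΩ lam hlam b ψ ρ Dρ hW hsol hρ hψ hb
  refine ⟨⟨hW.weakGrad, hW.fun_mem.mono_exponent ?_, hW.grad_mem.mono_exponent ?_⟩, ?_⟩
  · exact ENNReal.ofReal_le_of_le_toReal (by simpa using hσ'2.le)
  · exact ENNReal.ofReal_le_of_le_toReal (by simpa using hσ'2.le)
  intro M hM
  set K : Set (EuclideanSpace ℝ (Fin d)) := Metric.closedBall 0 (7 * R / 8) with hKdef
  have hK : IsCompact K := isCompact_closedBall _ _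
  have hKB : K ⊆ Metric.ball 0 R := Metric.closedBall_subset_ball (by linarith)
  have hKΩ : K ⊆ Ω := hKB.trans hBΩ
  have hρK : ∀ᵐ x ∂(volume.restrict K), 0 ≤ ρ x :=
    ae_restrict_of_ae_restrict_of_subset hKB hρ
  have iρ : IntegrableOn ρ K := hW.weakGrad.locInt_fun.integrableOn_compact_subset hKΩ hK
  obtain ⟨iB, hBle⟩ := integrableOn_and_ofReal_setIntegral_le hK hKB hk0 hρK
    iρ.aestronglyMeasurable.aemeasurable (hb K hK hKB)
  set A : ℝ := ∫ x in K, ρ x * ‖b x‖ ^ k with hA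
  have hA0 : 0 ≤ A := integral_nonneg_of_ae (hρK.mono fun x hx => mul_nonneg hx (by positivity))
  set Ψ : ℝ := (eLpNorm ψ (ENNReal.ofReal p') (volume.restrict (Metric.ball 0 R))).toReal with hΨ
  have hΨ0 : 0 ≤ Ψ := ENNReal.toReal_nonneg
  have hp'ne : ENNReal.ofReal p' ≠ 0 := by simpa using hp'0
  have iψ : IntegrableOn (fun x => |ψ x| ^ p') (Metric.ball 0 R) := by
    have := hψ.integrable_norm_rpow hp'ne ENNReal.ofReal_ne_top
    rwa [ENNReal.toReal_ofReal hp'0.le] at this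
  have hψint : ∫ x in K, |ψ x| ^ p' ≤ Ψ ^ p' := by
    refine (setIntegral_mono_set iψ (.of_forall fun x => by positivity) hKB.eventuallyLE).trans ?_
    rw [hΨ, hψ.eLpNorm_eq_integral_rpow_norm hp'ne ENNReal.ofReal_ne_top,
      ENNReal.toReal_ofReal (by positivity), ENNReal.toReal_ofReal hp'0.le,
      ← Real.rpow_mul (integral_nonneg fun x => by positivity), inv_mul_cancel₀ hp'0.ne',
      Real.rpow_one]
    rfl
  have hρint : ∫ x in K, ρ x ≤ M := by
    have h1 : ENNReal.ofReal (∫ x in K, ρ x) ≤ ENNReal.ofReal M := by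
      rw [ofReal_integral_eq_lintegral_ofReal iρ hρK, ENNReal.ofReal_coe_nnreal]
      refine le_trans ?_ ((eLpNorm_mono_measure ρ (Measure.restrict_mono hKB le_rfl)).trans hM)
      rw [eLpNorm_one_eq_lintegral_enorm]
      exact lintegral_mono fun x => Real.ofReal_le_enorm _
    exact (ENNReal.ofReal_le_ofReal_iff M.coe_nonneg).1 h1
  -- After division by S, the weighted drift integral, the norm of ψ and the mass of ρ are all at
  -- most 1. A is taken over the compact K, so it is finite even if the integral over the whole ball
  -- is not; the summand 1 keeps S positive.
  set S : ℝ := A + Ψ + M + 1 with hS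
  have hS0 : 0 < S := by have := M.coe_nonneg; positivity
  have hScale : ∀ {t : ℝ}, t ≤ S → S⁻¹ * t ≤ 1 := fun h => by
    rw [inv_mul_le_iff₀ hS0]; linarith
  have hmain := hC Ω hΩ hKΩ lam hlam.le b (fun x => S⁻¹ * ψ x) (fun x => S⁻¹ * ρ x)
    (fun x => S⁻¹ • Dρ x) (hW.weakGrad.const_smul _) (hsol.const_smul _)
    (by
      filter_upwards [(ae_restrict_iff' hK.measurableSet).1 hρK] with x hx
      by_cases hxK : x ∈ K
      · rw [indicator_of_mem hxK]
        exact mul_nonneg (by positivity) (hx hxK)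
      · rw [indicator_of_notMem hxK])
    (by
      simp_rw [mul_assoc]
      exact iB.const_mul S⁻¹)
    (by
      simp_rw [abs_mul, Real.mul_rpow (abs_nonneg _) (abs_nonneg _)]
      exact (iψ.mono_set hKB).const_mul _)
    (by
      simp_rw [mul_assoc, integral_const_mul]
      exact hScale (by have := M.coe_nonneg; linarith))
    (by
      simp_rw [abs_mul, Real.mul_rpow (abs_nonneg _) (abs_nonneg _), integral_const_mul,
        -- Unlike the other two integrals, that of |ψ|^p' is not homogeneous of degree one, so the
        -- comparison with S is made for its norm Ψ and then raised to the power p'.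
        abs_of_pos (inv_pos.2 hS0)]
      refine (mul_le_mul_of_nonneg_left hψint (by positivity)).trans ?_
      rw [← Real.mul_rpow (by positivity) hΨ0]
      exact Real.rpow_le_one (by positivity)
        (hScale (by have := M.coe_nonneg; linarith)) hp'0.le)
    (by
      simp_rw [integral_const_mul]
      exact hScale (by linarith))
  have e1 : ∀ (q : ℝ≥0∞) (ν : Measure (EuclideanSpace ℝ (Fin d))),
      eLpNorm (fun x => S⁻¹ * ρ x) q ν = ‖S⁻¹‖ₑ * eLpNorm ρ q ν := fun q ν =>
    eLpNorm_const_smul S⁻¹ ρ q ν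
  have e2 : ∀ (q : ℝ≥0∞) (ν : Measure (EuclideanSpace ℝ (Fin d))),
      eLpNorm (fun x => S⁻¹ • Dρ x) q ν = ‖S⁻¹‖ₑ * eLpNorm Dρ q ν := fun q ν =>
    eLpNorm_const_smul S⁻¹ Dρ q ν
  rw [e1, e2, ← mul_add] at hmain
  have hSinv : ENNReal.ofReal S * ‖S⁻¹‖ₑ = 1 := by
    rw [← ofReal_norm, Real.norm_of_nonneg (by positivity), ← ENNReal.ofReal_mul hS0.le,
      mul_inv_cancel₀ hS0.ne', ENNReal.ofReal_one]
  have hfin := mul_le_mul_right hmain (ENNReal.ofReal S)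
  rw [← mul_assoc, hSinv, one_mul] at hfin
  refine hfin.trans ?_
  have hSle : ENNReal.ofReal S ≤ (1 + (M : ℝ≥0∞)) *
      ((∫⁻ x, ‖b x‖ₑ ^ k ∂(densityMeasure (Metric.ball 0 R) ρ))
        + eLpNorm ψ (ENNReal.ofReal p') (volume.restrict (Metric.ball 0 R)) + 1) := by
    rw [hS, ENNReal.ofReal_add (by positivity) (by positivity),
      ENNReal.ofReal_add (by positivity) (by positivity),
      ENNReal.ofReal_add (by positivity) (by positivity), hΨ,
      ENNReal.ofReal_toReal hψ.eLpNorm_ne_top, ENNReal.ofReal_one, ENNReal.ofReal_coe_nnreal]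
    set Y := eLpNorm ψ (ENNReal.ofReal p') (volume.restrict (Metric.ball 0 R))
    set X := ∫⁻ x, ‖b x‖ₑ ^ k ∂(densityMeasure (Metric.ball 0 R) ρ)
    calc ENNReal.ofReal A + Y + M + 1 ≤ X + Y + M + 1 := by gcongr
      _ = (X + Y + 1) + M * 1 := by ring
      _ ≤ (X + Y + 1) + M * (X + Y + 1) := by gcongr; exact le_add_self
      _ = _ := by ring
  calc ENNReal.ofReal S * ENNReal.ofReal C
      ≤ (1 + (M : ℝ≥0∞)) * _ * ENNReal.ofReal C := mul_le_mul_left hSle _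
    _ = _ := by
      rw [ENNReal.coe_mul, ENNReal.coe_add, ENNReal.coe_one, mul_right_comm]
      rfl
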